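/- **Notation.** Let $n\ge 1$ and let $\mathcal B_n$ be Artin's braid group, with generators $\sigma_1,\dots,\sigma_{n-1}$ and relations $\sigma_i\sigma_j=\sigma_j\sigma_i$ for $|i-j|\ge 2$ and $\sigma_i\sigma_{i+1}\sigma_i=\sigma_{i+1}\sigma_i\sigma_{i+1}$. Let $\mathcal P_n$ be the pure braid group, the kernel of $\mathcal B_n\to S_n$, $\sigma_i\mapsto (i,i+1)$. Write $I$ for identity matrices, and index tensor products of matrices so that $X\otimes A$ is the block matrix $\begin{pmatrix} aX& bX\\ cX& dX\end{pmatrix}$ for $A=\begin{pmatrix} a&b\\c&d\end{pmatrix}$. Let $\pi_n$ be the representation of $\mathcal B_n$ on $(\mathbb C^2)^{\otimes n}$ given by $\pi_n(\sigma_i)=I_2^{\otimes (i-1)}\otimes R\otimes I_2^{\otimes (n-i-1)}$ with $$R=\tfrac1{\sqrt2}\begin{pmatrix}1&0&0&1\\0&1&-1&0\\0&1&1&0\\-1&0&0&1\end{pmatrix}.$$ For $m\ge 0$ let $\mathbf E_m^{-1}$ be the group generated by $x_1,\dots,x_m$ and a central element $-1$ of order two, with relations $x_i^2=-1$, $x_ix_j=x_jx_i$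 for $|i-j|\ge2$, and $x_{i+1}x_i=-x_ix_{i+1}$. All its representations considered are finite-dimensional over $\mathbb C$; such a representation is called odd if $-1$ acts as minus the identity. Put $s=\begin{pmatrix}0&1\\-1&0\end{pmatrix}$, $\sigma_z=\mathrm{diag}(1,-1)$, $\zeta=\frac{1+\sqrt{-1}}{\sqrt2}$, $d=\mathrm{diag}(\zeta,\bar\zeta)$, $D=\mathrm{diag}(\zeta,\bar\zeta,\bar\zeta,\zeta)$, $M=\frac1{\sqrt2}\begin{pmatrix}1&1\\-1&1\end{pmatrix}$. A subscript on a matrix below indicates the tensor factor, or the two neighbouring factors, on which it acts, with the identity on the other factors. **Theorem (decomposition of $\pi_n$).** *(1) $n=2k+1$ odd, $k\ge 0$.* The formulas $$\rho_1(x_1)=\sqrt{-1}\,(\sigma_z)_1,\quad \rho_1(x_{2i})=s_i,\quad \rho_1(x_{2i+1})=\sqrt{-1}\,(\sigma_z)_i(\sigma_z)_{i+1},\quad \rho_1(-1)=-I$$ define an irreducible odd representation of $\mathbf E_{2k}^{-1}$ on $V_1=(\mathbb C^2)^{\otimes k}$, of dimension $2^k$. Every odd irreducible representation of $\mathbf E_{2k}^{-1}$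 is isomorphic to $V_1$, and, if $k\ge1$, so is every irreducible representation of dimension $2^k$. The formulas $$\hat\rho_1(\sigma_1)=d_1,\quad \hat\rho_1(\sigma_{2i})=M_i,\quad \hat\rho_1(\sigma_{2i+1})=D_{i,i+1}$$ define an irreducible representation of $\mathcal B_n$ on $V_1$, and, as representations of $\mathcal B_n$, $$(\mathbb C^2)^{\otimes n}\cong(\mathbb C^2)^{\otimes (n+1)/2}\otimes V_1,$$ where $\mathcal B_n$ acts trivially on the first factor and through $\hat\rho_1$ on $V_1$. *(2) $n=2k$ even, $k\ge1$.* For $\epsilon=1$ and $\epsilon=-1$ the formulas for $\rho_1$ on $(\mathbb C^2)^{\otimes (k-1)}$ for $x_1,\dots,x_{2k-2}$ and $-1$, together with $x_{2k-1}\mapsto\epsilon\sqrt{-1}\,(\sigma_z)_{k-1}$ (the scalar $\epsilon\sqrt{-1}$ if $k=1$), define irreducible odd representations $(\lambda_1,W_1)$ and $(\lambda_2,W_2)$, respectively, of $\mathbf E_{2k-1}^{-1}$, of dimension $2^{k-1}$. They are inequivalent; every odd irreducible representation of $\mathbf E_{2k-1}^{-1}$ is isomorphic to one of them, and, if $k\ge2$,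 so is every irreducible representation of dimension $2^{k-1}$. The formulas for $\hat\rho_1$ on $(\mathbb C^2)^{\otimes (k-1)}$ for $\sigma_1,\dots,\sigma_{2k-2}$, together with $\sigma_{2k-1}\mapsto d_{k-1}$, respectively $\bar d_{k-1}$ (the scalar $\zeta$, respectively $\bar\zeta$, if $k=1$), define irreducible, inequivalent representations $\hat\lambda_1$ and $\hat\lambda_2$ of $\mathcal B_n$ on $W_1$ and $W_2$. The representation $\hat\lambda_1\oplus\hat\lambda_2$ is isomorphic to the restriction of the representation $\hat\rho_1$ of $\mathcal B_{2k+1}$ to $\mathcal B_{2k}$, and, as representations of $\mathcal B_n$, $$(\mathbb C^2)^{\otimes n}\cong(\mathbb C^2)^{\otimes n/2}\otimes (W_1\oplus W_2),$$ where $\mathcal B_n$ acts trivially on the first factor and through $\hat\lambda_1\oplus\hat\lambda_2$ on the second. *(3) Restriction to pure braids.* In both cases there is a homomorphism $\theta:\mathcal P_n\to\mathbf E_{n-1}^{-1}$ with $\theta(\sigma_i^2)=x_i$ for all $i$ and with the same kernel as $\pi_n|_{\mathcal P_n}$, surjective if $n\ge2$, such that $\hat\rho_1|_{\mathcal P_n}=\rho_1\circ\theta$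 for $n$ odd and $\hat\lambda_j|_{\mathcal P_n}=\lambda_j\circ\theta$ ($j=1,2$) for $n$ even. Thus, as representations of $\mathcal P_n$, where $\mathcal P_n$ acts on $V_1,W_1,W_2$ through $\theta$ and trivially on the first tensor factor, $(\mathbb C^2)^{\otimes n}$ is $(\mathbb C^2)^{\otimes (n+1)/2}\otimes V_1$ for $n$ odd and $(\mathbb C^2)^{\otimes n/2}\otimes(W_1\oplus W_2)$ for $n$ even. -/

import Mathlib

open scoped TensorProduct

universe u

/-! ## Braid groups -/

/-- The defining relations of Artin's braid group on `n` strands; the generators are numbered from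
`0`, so that the generator with index `i` crosses the strands `i` and `i + 1`. -/
inductive BraidRel (n : ℕ) : FreeGroup (Fin (n - 1)) → Prop
  | far (i j : Fin (n - 1)) (h : (i : ℕ) + 2 ≤ j) :
      BraidRel n (FreeGroup.of i * FreeGroup.of j * (FreeGroup.of j * FreeGroup.of i)⁻¹)
  | braid (i j : Fin (n - 1)) (h : (i : ℕ) + 1 = j) :
      BraidRel n (FreeGroup.of i * FreeGroup.of j * FreeGroup.of i *
        (FreeGroup.of j * FreeGroup.of i * FreeGroup.of j)⁻¹)

/-- Artin's braid group on `n` strands. -/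
abbrev BraidGroup (n : ℕ) : Type := PresentedGroup {r | BraidRel n r}

/-- The standard generators of the braid group. -/
def BraidGroup.σ {n : ℕ} (i : Fin (n - 1)) : BraidGroup n := PresentedGroup.of i

/-- The homomorphism out of the braid group given by elements which satisfy its relations. -/
def BraidGroup.lift {n : ℕ} {G : Type*} [Group G] (f : Fin (n - 1) → G)
    (hfar : ∀ i j : Fin (n - 1), (i : ℕ) + 2 ≤ j → f i * f j = f j * f i)
    (hbraid : ∀ i j : Fin (n - 1), (i : ℕ) + 1 = j → f i * f j * f i = f j * f i * f j) :
    BraidGroup n →* G :=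
  PresentedGroup.toGroup (f := f) (by
    rintro r hr
    cases hr with
    | far i j h => simp [hfar i j h]
    | braid i j h =>
      simp only [map_mul, map_inv, FreeGroup.lift_apply_of]
      rw [hbraid i j h, mul_inv_cancel])

theorem BraidGroup.lift_σ {n : ℕ} {G : Type*} [Group G] (f : Fin (n - 1) → G) (hfar) (hbraid)
    (i : Fin (n - 1)) : BraidGroup.lift f hfar hbraid (BraidGroup.σ i) = f i := by
  simp [BraidGroup.lift, BraidGroup.σ]

/-- The adjacent transposition of the strands `i` and `i + 1`. -/
def adjSwap {n : ℕ} (i : Fin (n - 1)) : Equiv.Perm (Fin n) :=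
  Equiv.swap ⟨i, by omega⟩ ⟨i + 1, by omega⟩

/-- The permutation of the strands underlying a braid, `σ i ↦ (i, i + 1)`. -/
def BraidGroup.toPerm (n : ℕ) : BraidGroup n →* Equiv.Perm (Fin n) :=
  BraidGroup.lift adjSwap
    (by
      intro i j h
      refine (Equiv.Perm.Disjoint.commute ?_).eq
      refine Equiv.Perm.disjoint_swap_swap ?_
      simp [Fin.ext_iff]
      omega)
    (by
      rintro ⟨i, hi⟩ ⟨j, hj⟩ h
      simp only at h
      subst h
      have h1 : (⟨i, by omega⟩ : Fin n) ≠ ⟨i + 1, by omega⟩ := by simp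
      have h2 : (⟨i, by omega⟩ : Fin n) ≠ ⟨i + 1 + 1, by omega⟩ := by simp; omega
      have h3 : (⟨i + 1, by omega⟩ : Fin n) ≠ ⟨i + 1 + 1, by omega⟩ := by simp
      have e1 := Equiv.swap_mul_swap_mul_swap h3.symm h2.symm
      have e2 := Equiv.swap_mul_swap_mul_swap h1 h2
      rw [Equiv.swap_comm (⟨i + 1, by omega⟩ : Fin n) ⟨i, by omega⟩,
        Equiv.swap_comm (⟨i + 1 + 1, by omega⟩ : Fin n) ⟨i + 1, by omega⟩] at e1
      rw [Equiv.swap_comm (⟨i + 1 + 1, by omega⟩ : Fin n) ⟨i, by omega⟩] at e2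
      exact e1.trans e2.symm)

/-- The pure braid group: the braids whose underlying permutation is trivial. -/
abbrev PureBraidGroup (n : ℕ) : Subgroup (BraidGroup n) := (BraidGroup.toPerm n).ker

/-- The pure braid `σ i ^ 2`. -/
def PureBraidGroup.σsq {n : ℕ} (i : Fin (n - 1)) : PureBraidGroup n :=
  ⟨BraidGroup.σ i ^ 2, by
    simp [MonoidHom.mem_ker, BraidGroup.toPerm, BraidGroup.lift_σ, adjSwap, pow_two]⟩

/-- The standard homomorphism of the braid group on `n` strands into the one on `n + 1` strands,
which adds a last strand. -/
def BraidGroup.addStrand (n : ℕ) : BraidGroup n →* BraidGroup (n + 1) :=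
  BraidGroup.lift (fun i => BraidGroup.σ ⟨i, by omega⟩)
    (by
      intro i j h
      exact PresentedGroup.mk_eq_mk_of_mul_inv_mem (BraidRel.far (n := n + 1) _ _ h))
    (by
      intro i j h
      exact PresentedGroup.mk_eq_mk_of_mul_inv_mem (BraidRel.braid (n := n + 1) _ _ h))

/-! ## The nearly extraspecial 2-groups -/

/-- The defining relations of the group with generators `x 0, …, x (m - 1)` (here `some i`) and an
additional generator (here `none`), written `-1`, which is central of order two, where
`x i ^ 2 = -1`, neighbouring generators anticommute and the others commute. -/
inductive NearlyExtraspecialRel (m : ℕ) : FreeGroup (Option (Fin m)) → Prop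
  | neg_sq : NearlyExtraspecialRel m (FreeGroup.of none * FreeGroup.of none)
  | neg_central (i : Fin m) :
      NearlyExtraspecialRel m (FreeGroup.of none * FreeGroup.of (some i) *
        (FreeGroup.of (some i) * FreeGroup.of none)⁻¹)
  | sq (i : Fin m) :
      NearlyExtraspecialRel m (FreeGroup.of (some i) * FreeGroup.of (some i) *
        (FreeGroup.of none)⁻¹)
  | far (i j : Fin m) (h : (i : ℕ) + 2 ≤ j) :
      NearlyExtraspecialRel m (FreeGroup.of (some i) * FreeGroup.of (some j) *
        (FreeGroup.of (some j) * FreeGroup.of (some i))⁻¹)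
  | anti (i j : Fin m) (h : (i : ℕ) + 1 = j) :
      NearlyExtraspecialRel m (FreeGroup.of (some j) * FreeGroup.of (some i) *
        (FreeGroup.of none * (FreeGroup.of (some i) * FreeGroup.of (some j)))⁻¹)

/-- The (nearly) extraspecial 2-group on `m` generators of square `-1`. -/
abbrev NearlyExtraspecial (m : ℕ) : Type := PresentedGroup {r | NearlyExtraspecialRel m r}

/-- The standard generators. -/
def NearlyExtraspecial.x {m : ℕ} (i : Fin m) : NearlyExtraspecial m := PresentedGroup.of (some i)

/-- The central element `-1`. -/
def NearlyExtraspecial.negOne (m : ℕ) : NearlyExtraspecial m := PresentedGroup.of none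

/-- A representation is odd if the central element `-1` acts as minus the identity. -/
def IsOddRep {m : ℕ} {V : Type*} [AddCommGroup V] [Module ℂ V]
    (τ : Representation ℂ (NearlyExtraspecial m) V) : Prop :=
  τ (NearlyExtraspecial.negOne m) = -1

/-! ## Representations given by operators which satisfy the defining relations -/

/-- The first `m` members of the sequence `J` satisfy the relations of the nearly extraspecial
group, with `-1` interpreted as minus the identity. -/
structure ExtraspecialRelations {A : Type*} [Ring A] (m : ℕ) (J : ℕ → A) : Prop where
  sq : ∀ i < m, J i * J i = -1
  far : ∀ i j, i + 2 ≤ j → j < m → J i * J j = J j * J i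
  anti : ∀ i, i + 1 < m → J (i + 1) * J i = -(J i * J (i + 1))

/-- The first `n - 1` members of the sequence `T` are invertible and satisfy the relations of the
braid group on `n` strands. -/
structure BraidRelations {A : Type*} [Ring A] (n : ℕ) (T : ℕ → A) : Prop where
  isUnit : ∀ i < n - 1, IsUnit (T i)
  far : ∀ i j, i + 2 ≤ j → j < n - 1 → T i * T j = T j * T i
  braid : ∀ i, i + 1 < n - 1 → T i * T (i + 1) * T i = T (i + 1) * T i * T (i + 1)

/-- The representation `x i ↦ J i`, `-1 ↦ -1`. -/
noncomputable def extraspecialRep {V : Type*} [AddCommGroup V] [Module ℂ V] {m : ℕ}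
    {J : ℕ → Module.End ℂ V} (h : ExtraspecialRelations m J) :
    Representation ℂ (NearlyExtraspecial m) V :=
  (Units.coeHom (Module.End ℂ V)).comp
    (PresentedGroup.toGroup
      (f := fun o : Option (Fin m) => o.elim (-1 : (Module.End ℂ V)ˣ)
        fun i => ⟨J i, -J i, by simp [h.sq i i.2], by simp [h.sq i i.2]⟩)
      (by
        rintro r hr
        cases hr with
        | neg_sq => simp
        | neg_central i =>
          simp only [map_mul, map_inv, FreeGroup.lift_apply_of, mul_inv_eq_one]
          ext1
          simp
        | sq i =>
          simp only [map_mul, map_inv, FreeGroup.lift_apply_of, mul_inv_eq_one]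
          ext1
          simp [h.sq i i.2]
        | far i j hij =>
          simp only [map_mul, map_inv, FreeGroup.lift_apply_of, mul_inv_eq_one]
          ext1
          simp [h.far i j hij j.2]
        | anti i j hij =>
          simp only [map_mul, map_inv, FreeGroup.lift_apply_of, mul_inv_eq_one]
          ext1
          have := h.anti i (by omega)
          rw [hij] at this
          simp [this]))

theorem extraspecialRep_x {V : Type*} [AddCommGroup V] [Module ℂ V] {m : ℕ}
    {J : ℕ → Module.End ℂ V} (h : ExtraspecialRelations m J) (i : Fin m) :
    extraspecialRep h (NearlyExtraspecial.x i) = J i := by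
  simp [extraspecialRep, NearlyExtraspecial.x]

theorem extraspecialRep_negOne {V : Type*} [AddCommGroup V] [Module ℂ V] {m : ℕ}
    {J : ℕ → Module.End ℂ V} (h : ExtraspecialRelations m J) :
    extraspecialRep h (NearlyExtraspecial.negOne m) = -1 := by
  simp [extraspecialRep, NearlyExtraspecial.negOne]

/-- The representation `σ i ↦ T i`. -/
noncomputable def braidRep {V : Type*} [AddCommGroup V] [Module ℂ V] {n : ℕ}
    {T : ℕ → Module.End ℂ V} (h : BraidRelations n T) : Representation ℂ (BraidGroup n) V :=
  (Units.coeHom (Module.End ℂ V)).comp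
    (BraidGroup.lift (fun i : Fin (n - 1) => (h.isUnit i i.2).unit)
      (by
        intro i j hij
        ext1
        simp [h.far i j hij j.2])
      (by
        intro i j hij
        ext1
        have := h.braid i (by omega)
        rw [hij] at this
        simp [this]))

theorem braidRep_σ {V : Type*} [AddCommGroup V] [Module ℂ V] {n : ℕ}
    {T : ℕ → Module.End ℂ V} (h : BraidRelations n T) (i : Fin (n - 1)) :
    braidRep h (BraidGroup.σ i) = T i := by
  simp [braidRep, BraidGroup.lift_σ]

theorem sqrtTwo_inv_sq : ((√2 : ℝ) : ℂ)⁻¹ * ((√2 : ℝ) : ℂ)⁻¹ = 1 / 2 := by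
  rw [← mul_inv, ← Complex.ofReal_mul, Real.mul_self_sqrt (by norm_num)]
  norm_num

theorem ExtraspecialRelations.braidRelations {A : Type*} [Ring A] [Algebra ℂ A] {n : ℕ}
    {J T : ℕ → A} (h : ExtraspecialRelations (n - 1) J)
    (hT : ∀ i < n - 1, T i = (((√2 : ℝ) : ℂ)⁻¹) • (1 + J i)) : BraidRelations n T where
  isUnit i hi := by
    have hs := h.sq i hi
    have key : (1 + J i) * (1 - J i) = (2 : ℂ) • (1 : A) := by
      have : (1 + J i) * (1 - J i) = 1 - J i * J i := by noncomm_ring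
      rw [this, hs, two_smul]; abel
    have key' : (1 - J i) * (1 + J i) = (2 : ℂ) • (1 : A) := by
      have : (1 - J i) * (1 + J i) = 1 - J i * J i := by noncomm_ring
      rw [this, hs, two_smul]; abel
    refine ⟨⟨T i, (((√2 : ℝ) : ℂ)⁻¹) • (1 - J i), ?_, ?_⟩, rfl⟩
    · rw [hT i hi, smul_mul_smul_comm, sqrtTwo_inv_sq, key, smul_smul]; norm_num
    · rw [hT i hi, smul_mul_smul_comm, sqrtTwo_inv_sq, key', smul_smul]; norm_num
  far i j hij hj := by
    rw [hT i (by omega), hT j hj, smul_mul_smul_comm, smul_mul_smul_comm]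
    have := h.far i j hij hj
    congr 1
    simp only [mul_add, add_mul, this, mul_one, one_mul]
    abel
  braid i hi := by
    rw [hT i (by omega), hT (i + 1) hi]
    have ha := h.anti i hi
    have h1 := h.sq i (by omega)
    have h2 := h.sq (i + 1) hi
    generalize J i = a at *
    generalize J (i + 1) = b at *
    simp only [smul_mul_smul_comm]
    congr 1
    have e1 : a * b * a = b := by
      rw [mul_assoc, ha, mul_neg, ← mul_assoc, h1]; simp
    have e2 : b * a * b = a := by
      rw [ha, neg_mul, mul_assoc, h2]; simp
    have l : (1 + a) * (1 + b) * (1 + a) = 1 + a + a + b + a * a + (a * b + b * a) + a * b * a := by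
      noncomm_ring
    have r : (1 + b) * (1 + a) * (1 + b) = 1 + b + b + a + b * b + (a * b + b * a) + b * a * b := by
      noncomm_ring
    rw [l, r, e1, e2, h1, h2]
    abel

/-! ## Operators on tensor powers of `ℂ²` -/

/-- The tensor power `(ℂ²)^{⊗ n}`; its factors are numbered from `0`. -/
def Qubits (n : ℕ) : Type := ⨂[ℂ] _ : Fin n, (Fin 2 → ℂ)

noncomputable instance (n : ℕ) : AddCommGroup (Qubits n) :=
  inferInstanceAs (AddCommGroup (⨂[ℂ] _ : Fin n, (Fin 2 → ℂ)))

noncomputable instance (n : ℕ) : Module ℂ (Qubits n) :=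
  inferInstanceAs (Module ℂ (⨂[ℂ] _ : Fin n, (Fin 2 → ℂ)))

/-- The operator `X 0 ⊗ ⋯ ⊗ X (n - 1)`. -/
noncomputable def tensorOp {n : ℕ} (X : Fin n → Module.End ℂ (Fin 2 → ℂ)) :
    Module.End ℂ (Qubits n) :=
  (PiTensorProduct.map X : (⨂[ℂ] _ : Fin n, (Fin 2 → ℂ)) →ₗ[ℂ] ⨂[ℂ] _ : Fin n, (Fin 2 → ℂ))

theorem tensorOp_mul {n : ℕ} (X Y : Fin n → Module.End ℂ (Fin 2 → ℂ)) :
    tensorOp X * tensorOp Y = tensorOp fun q => X q * Y q :=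
  (PiTensorProduct.map_mul X Y).symm

theorem tensorOp_one (n : ℕ) :
    tensorOp (fun _ : Fin n => (1 : Module.End ℂ (Fin 2 → ℂ))) = 1 :=
  PiTensorProduct.map_one

theorem tensorOp_update_add {n : ℕ} (X : Fin n → Module.End ℂ (Fin 2 → ℂ)) (p : Fin n)
    (U V : Module.End ℂ (Fin 2 → ℂ)) :
    tensorOp (Function.update X p (U + V)) =
      tensorOp (Function.update X p U) + tensorOp (Function.update X p V) :=
  PiTensorProduct.map_update_add X p U V

theorem tensorOp_update_smul {n : ℕ} (X : Fin n → Module.End ℂ (Fin 2 → ℂ)) (p : Fin n) (c : ℂ)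
    (U : Module.End ℂ (Fin 2 → ℂ)) :
    tensorOp (Function.update X p (c • U)) = c • tensorOp (Function.update X p U) :=
  PiTensorProduct.map_update_smul X p c U

/-- The operator `I ⊗ ⋯ ⊗ I ⊗ X ⊗ I ⊗ ⋯ ⊗ I` with the matrix `X` on the factor `p`. -/
noncomputable def site {n : ℕ} (p : ℕ) (X : Matrix (Fin 2) (Fin 2) ℂ) : Module.End ℂ (Qubits n) :=
  tensorOp fun q : Fin n => if (q : ℕ) = p then Matrix.toLin' X else 1

/-- The position of the basis vector `e_a ⊗ e_b` of `ℂ² ⊗ ℂ²` in the ordering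
`e₀ ⊗ e₀, e₁ ⊗ e₀, e₀ ⊗ e₁, e₁ ⊗ e₁`, i.e. `a + 2 b`. This is the ordering for which the matrix of
`X ⊗ A` consists of the blocks `A i j • X`. -/
def pairIndex (a b : Fin 2) : Fin 4 := finProdFinEquiv (m := 2) (n := 2) (b, a)

/-- The operator `I ⊗ ⋯ ⊗ I ⊗ A ⊗ I ⊗ ⋯ ⊗ I` with the `4 × 4` matrix `A` on the factors `p` and
`q`: the operator which depends linearly on `A` and is `site p X * site q Y` for `A = X ⊗ Y`. -/
noncomputable def sitePair {n : ℕ} (p q : ℕ) (A : Matrix (Fin 4) (Fin 4) ℂ) :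
    Module.End ℂ (Qubits n) :=
  ∑ a : Fin 2, ∑ b : Fin 2, ∑ a' : Fin 2, ∑ b' : Fin 2,
    A (pairIndex a a') (pairIndex b b') •
      (site p (Matrix.single a b 1) * site q (Matrix.single a' b' 1))

theorem site_mul {n : ℕ} (p : ℕ) (X Y : Matrix (Fin 2) (Fin 2) ℂ) :
    (site p X * site p Y : Module.End ℂ (Qubits n)) = site p (X * Y) := by
  unfold site
  rw [tensorOp_mul]
  congr 1
  ext1 q
  split_ifs with h
  · exact (Matrix.toLin'_mul X Y).symm
  · rfl

theorem site_comm {n : ℕ} {p q : ℕ} (hpq : p ≠ q) (X Y : Matrix (Fin 2) (Fin 2) ℂ) :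
    (site p X * site q Y : Module.End ℂ (Qubits n)) = site q Y * site p X := by
  unfold site
  rw [tensorOp_mul, tensorOp_mul]
  congr 1
  ext1 r
  by_cases h : (r : ℕ) = p
  · have : ¬ (r : ℕ) = q := fun h' => hpq (h.symm.trans h')
    simp only [if_pos h, if_neg this]; rfl
  · simp only [if_neg h]; rfl

theorem site_one {n : ℕ} (p : ℕ) : (site p 1 : Module.End ℂ (Qubits n)) = 1 := by
  unfold site
  rw [← tensorOp_one]
  congr 1
  ext1 q
  split_ifs
  · exact Matrix.toLin'_one
  · rfl

theorem site_eq_update {n : ℕ} (p : Fin n) (X : Matrix (Fin 2) (Fin 2) ℂ) :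
    (site p X : Module.End ℂ (Qubits n)) =
      tensorOp (Function.update (fun _ => 1) p (Matrix.toLin' X)) := by
  unfold site
  congr 1
  ext1 q
  by_cases h : q = p
  · subst h; simp
  · simp [h, Fin.val_inj]

/-- `site` as a linear map in the matrix. -/
noncomputable def siteLinear {n : ℕ} (p : Fin n) :
    Matrix (Fin 2) (Fin 2) ℂ →ₗ[ℂ] Module.End ℂ (Qubits n) where
  toFun := site p
  map_add' X Y := by
    simp only [site_eq_update, map_add]
    exact tensorOp_update_add _ p _ _
  map_smul' c X := by
    simp only [site_eq_update, map_smul]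
    exact tensorOp_update_smul _ p _ _

theorem site_neg {n p : ℕ} (hp : p < n) (X : Matrix (Fin 2) (Fin 2) ℂ) :
    (site p (-X) : Module.End ℂ (Qubits n)) = -site p X :=
  map_neg (siteLinear ⟨p, hp⟩) X

theorem site_smul_add {n p : ℕ} (hp : p < n) (c t : ℂ) (X : Matrix (Fin 2) (Fin 2) ℂ) :
    (site p (c • (1 + t • X)) : Module.End ℂ (Qubits n)) = c • (1 + t • site p X) := by
  have h := (siteLinear ⟨p, hp⟩).map_smul c (1 + t • X)
  have h' := (siteLinear ⟨p, hp⟩).map_add 1 (t • X)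
  have h'' := (siteLinear ⟨p, hp⟩).map_smul t X
  rw [h', h''] at h
  rw [← site_one p]
  exact h

theorem site_eq_sum {n p : ℕ} (hp : p < n) (X : Matrix (Fin 2) (Fin 2) ℂ) :
    (site p X : Module.End ℂ (Qubits n)) =
      ∑ a : Fin 2, ∑ b : Fin 2, X a b • site p (Matrix.single a b 1) := by
  have h : X = ∑ a : Fin 2, ∑ b : Fin 2, X a b • Matrix.single a b (1 : ℂ) := by
    conv_lhs => rw [Matrix.matrix_eq_sum_single X]
    simp [Matrix.smul_single]
  have h2 := congrArg (siteLinear ⟨p, hp⟩) h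
  simp only [map_sum, map_smul] at h2
  exact h2

theorem sitePair_eq {n p q : ℕ} (hp : p < n) (hq : q < n) (A : Matrix (Fin 4) (Fin 4) ℂ) (c t : ℂ)
    (X Y : Matrix (Fin 2) (Fin 2) ℂ)
    (hA : ∀ a b a' b', A (pairIndex a a') (pairIndex b b') =
      c * ((1 : Matrix (Fin 2) (Fin 2) ℂ) a b * (1 : Matrix (Fin 2) (Fin 2) ℂ) a' b' +
        t * (X a b * Y a' b'))) :
    (sitePair p q A : Module.End ℂ (Qubits n)) = c • (1 + t • (site p X * site q Y)) := by
  have key : ∀ U V : Matrix (Fin 2) (Fin 2) ℂ, (site p U * site q V : Module.End ℂ (Qubits n)) =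
      ∑ a : Fin 2, ∑ b : Fin 2, ∑ a' : Fin 2, ∑ b' : Fin 2, (U a b * V a' b') •
        (site p (Matrix.single a b 1) * site q (Matrix.single a' b' 1)) := by
    intro U V
    rw [site_eq_sum hp U, site_eq_sum hq V]
    simp only [Fin.sum_univ_two, mul_add, add_mul, smul_mul_smul_comm]
    abel
  have h1 : (1 : Module.End ℂ (Qubits n)) = site p 1 * site q 1 := by
    rw [site_one, site_one, one_mul]
  rw [h1, key, key]
  simp only [sitePair, hA, Finset.smul_sum, smul_smul, ← Finset.sum_add_distrib, ← add_smul,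
    mul_add]

/-! ## The matrices -/

/-- The solution of the Yang–Baxter equation. -/
noncomputable def matR : Matrix (Fin 4) (Fin 4) ℂ :=
  (((√2 : ℝ) : ℂ)⁻¹) • !![1, 0, 0, 1; 0, 1, -1, 0; 0, 1, 1, 0; -1, 0, 0, 1]

def matS : Matrix (Fin 2) (Fin 2) ℂ := !![0, 1; -1, 0]

def matσx : Matrix (Fin 2) (Fin 2) ℂ := !![0, 1; 1, 0]

def matσz : Matrix (Fin 2) (Fin 2) ℂ := !![1, 0; 0, -1]

/-- The primitive eighth root of unity `(1 + √-1) / √2`. -/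
noncomputable def zeta8 : ℂ := (((√2 : ℝ) : ℂ)⁻¹) * (1 + Complex.I)

/-- The complex conjugate of `zeta8`. -/
noncomputable def zeta8bar : ℂ := starRingEnd ℂ zeta8

noncomputable def matd : Matrix (Fin 2) (Fin 2) ℂ := !![zeta8, 0; 0, zeta8bar]

/-- The complex conjugate of `matd`. -/
noncomputable def matdbar : Matrix (Fin 2) (Fin 2) ℂ := !![zeta8bar, 0; 0, zeta8]

noncomputable def matD : Matrix (Fin 4) (Fin 4) ℂ :=
  !![zeta8, 0, 0, 0; 0, zeta8bar, 0, 0; 0, 0, zeta8bar, 0; 0, 0, 0, zeta8]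

noncomputable def matM : Matrix (Fin 2) (Fin 2) ℂ := (((√2 : ℝ) : ℂ)⁻¹) • !![1, 1; -1, 1]

/-! ## The representation on `(ℂ²)^{⊗ n}` given by the Yang–Baxter operator -/

theorem zeta8bar_eq : zeta8bar = (((√2 : ℝ) : ℂ)⁻¹) * (1 - Complex.I) := by
  simp [zeta8bar, zeta8, sub_eq_add_neg]

theorem matS_sq : matS * matS = -1 := by
  ext i j; fin_cases i <;> fin_cases j <;> simp [matS]

theorem matσx_sq : matσx * matσx = 1 := by
  ext i j; fin_cases i <;> fin_cases j <;> simp [matσx]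

theorem matσz_sq : matσz * matσz = 1 := by
  ext i j; fin_cases i <;> fin_cases j <;> simp [matσz]

theorem matσx_mul_matS : matσx * matS = -(matS * matσx) := by
  ext i j; fin_cases i <;> fin_cases j <;> simp [matσx, matS]

theorem matσz_mul_matS : matσz * matS = -(matS * matσz) := by
  ext i j; fin_cases i <;> fin_cases j <;> simp [matσz, matS]

theorem sitePair_matR {n p : ℕ} (hp : p + 1 < n) :
    (sitePair p (p + 1) matR : Module.End ℂ (Qubits n)) =
      (((√2 : ℝ) : ℂ)⁻¹) • (1 + site p matS * site (p + 1) matσx) := by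
  rw [sitePair_eq (n := n) (by omega) hp matR (((√2 : ℝ) : ℂ)⁻¹) 1 matS matσx, one_smul]
  intro a b a' b'
  fin_cases a <;> fin_cases b <;> fin_cases a' <;> fin_cases b' <;>
    simp [matR, matS, matσx, pairIndex, finProdFinEquiv]

theorem sitePair_matD {n p : ℕ} (hp : p + 1 < n) :
    (sitePair p (p + 1) matD : Module.End ℂ (Qubits n)) =
      (((√2 : ℝ) : ℂ)⁻¹) • (1 + Complex.I • (site p matσz * site (p + 1) matσz)) := by
  rw [sitePair_eq (n := n) (by omega) hp matD]
  intro a b a' b'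
  fin_cases a <;> fin_cases b <;> fin_cases a' <;> fin_cases b' <;>
    simp [matD, matσz, pairIndex, finProdFinEquiv, zeta8, zeta8bar_eq, sub_eq_add_neg]

theorem yangBaxter_extraspecialRelations (n : ℕ) :
    ExtraspecialRelations (n - 1)
      (fun i => (site i matS * site (i + 1) matσx : Module.End ℂ (Qubits n))) where
  sq i hi := by
    have hc := site_comm (n := n) (show i + 1 ≠ i by omega) matσx matS
    calc (site i matS * site (i + 1) matσx * (site i matS * site (i + 1) matσx) :
            Module.End ℂ (Qubits n))
        = site i matS * (site (i + 1) matσx * site i matS) * site (i + 1) matσx := by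
          noncomm_ring
      _ = (site i matS * site i matS) * (site (i + 1) matσx * site (i + 1) matσx) := by
          rw [hc]; noncomm_ring
      _ = -1 := by
          rw [site_mul, site_mul, matS_sq, matσx_sq, site_neg (by omega), site_one, site_one,
            mul_one]
  far i j hij hj := by
    have h1 : Commute (site i matS : Module.End ℂ (Qubits n)) (site j matS) :=
      site_comm (by omega) _ _
    have h2 : Commute (site i matS : Module.End ℂ (Qubits n)) (site (j + 1) matσx) :=
      site_comm (by omega) _ _
    have h3 : Commute (site (i + 1) matσx : Module.End ℂ (Qubits n)) (site j matS) :=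
      site_comm (by omega) _ _
    have h4 : Commute (site (i + 1) matσx : Module.End ℂ (Qubits n)) (site (j + 1) matσx) :=
      site_comm (by omega) _ _
    exact ((h1.mul_right h2).mul_left (h3.mul_right h4)).eq
  anti i hi := by
    have hx : (site (i + 1) matσx * site (i + 1) matS : Module.End ℂ (Qubits n)) =
        -(site (i + 1) matS * site (i + 1) matσx) := by
      rw [site_mul, site_mul, matσx_mul_matS, site_neg (by omega)]
    have h1 : (site (i + 1 + 1) matσx * site i matS : Module.End ℂ (Qubits n)) =
        site i matS * site (i + 1 + 1) matσx := site_comm (by omega) _ _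
    have h2 : (site (i + 1) matS * site i matS : Module.End ℂ (Qubits n)) =
        site i matS * site (i + 1) matS := site_comm (by omega) _ _
    have h3 : (site (i + 1 + 1) matσx * site (i + 1) matσx : Module.End ℂ (Qubits n)) =
        site (i + 1) matσx * site (i + 1 + 1) matσx := site_comm (by omega) _ _
    generalize (site (i + 1) matσx : Module.End ℂ (Qubits n)) = b at *
    generalize (site (i + 1) matS : Module.End ℂ (Qubits n)) = c at *
    generalize (site i matS : Module.End ℂ (Qubits n)) = a at *
    generalize (site (i + 1 + 1) matσx : Module.End ℂ (Qubits n)) = e at *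
    calc c * e * (a * b) = c * (e * a) * b := by noncomm_ring
      _ = (c * a) * (e * b) := by rw [h1]; noncomm_ring
      _ = a * (c * b) * e := by rw [h2, h3]; noncomm_ring
      _ = -(a * (b * c) * e) := by rw [hx]; simp
      _ = -(a * b * (c * e)) := by noncomm_ring

theorem yangBaxter_braidRelations (n : ℕ) :
    BraidRelations n (fun i => (sitePair i (i + 1) matR : Module.End ℂ (Qubits n))) :=
  (yangBaxter_extraspecialRelations n).braidRelations
    fun i hi => sitePair_matR (by omega)

/-- The representation `π_n` of the braid group on `(ℂ²)^{⊗ n}` in which `σ i` acts as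
`I ⊗ ⋯ ⊗ I ⊗ R ⊗ I ⊗ ⋯ ⊗ I`, with `R` on the factors `i` and `i + 1`. -/
noncomputable def yangBaxterRep (n : ℕ) : Representation ℂ (BraidGroup n) (Qubits n) :=
  braidRep (yangBaxter_braidRelations n)

/-! ## The odd representations of the nearly extraspecial groups -/

/-- The operators `√-1 σ_z ⊗ I ⊗ ⋯`, `s ⊗ I ⊗ ⋯`, `√-1 σ_z ⊗ σ_z ⊗ I ⊗ ⋯`, `I ⊗ s ⊗ I ⊗ ⋯`, … on
`(ℂ²)^{⊗ k}`; only those with index `< 2 k` are used. -/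
noncomputable def rhoOp (k : ℕ) : ℕ → Module.End ℂ (Qubits k)
  | 0 => Complex.I • site 0 matσz
  | i + 1 =>
    if Even i then site (i / 2) matS
    else Complex.I • (site (i / 2) matσz * site (i / 2 + 1) matσz)

/-- The operators `rhoOp k i` for `i < 2 k`, followed by `± √-1 I ⊗ ⋯ ⊗ I ⊗ σ_z` for `i = 2 k`,
which is to be read as the scalar `± √-1` if `k = 0`. -/
noncomputable def lambdaOp (k : ℕ) (ε : ℤˣ) (i : ℕ) : Module.End ℂ (Qubits k) :=
  if i < 2 * k then rhoOp k i
  else (((ε : ℤ) : ℂ) * Complex.I) • (if k = 0 then 1 else site (k - 1) matσz)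

/-- `rhoOp` for the braid group: the operators `d ⊗ I ⊗ ⋯`, `M ⊗ I ⊗ ⋯`, `D ⊗ I ⊗ ⋯`,
`I ⊗ M ⊗ I ⊗ ⋯`, `I ⊗ D ⊗ I ⊗ ⋯`, …. -/
noncomputable def rhoHatOp (k : ℕ) : ℕ → Module.End ℂ (Qubits k)
  | 0 => site 0 matd
  | i + 1 => if Even i then site (i / 2) matM else sitePair (i / 2) (i / 2 + 1) matD

/-- `lambdaOp` for the braid group: the operators `rhoHatOp k i` for `i < 2 k`, followed by
`I ⊗ ⋯ ⊗ I ⊗ d`, respectively `I ⊗ ⋯ ⊗ I ⊗ d̄`, for `i = 2 k`, which is to be read as the scalar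
`ζ`, respectively its conjugate, if `k = 0`. -/
noncomputable def lambdaHatOp (k : ℕ) (ε : ℤˣ) (i : ℕ) : Module.End ℂ (Qubits k) :=
  if i < 2 * k then rhoHatOp k i
  else if k = 0 then (if ε = 1 then zeta8 else zeta8bar) • 1
  else site (k - 1) (if ε = 1 then matd else matdbar)

/-- `σ_z` on the factors `j - 1` and `j`, where a factor which does not exist is omitted. -/
noncomputable def zzOp (k : ℕ) : ℕ → Module.End ℂ (Qubits k)
  | 0 => site 0 matσz
  | j + 1 => site j matσz * site (j + 1) matσz

theorem site_of_le {n p : ℕ} (h : n ≤ p) (X : Matrix (Fin 2) (Fin 2) ℂ) :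
    (site p X : Module.End ℂ (Qubits n)) = 1 := by
  unfold site
  rw [← tensorOp_one]
  congr 1
  ext1 q
  rw [if_neg (by omega)]

theorem site_matσz_commute (n p q : ℕ) :
    Commute (site p matσz : Module.End ℂ (Qubits n)) (site q matσz) := by
  by_cases h : p = q
  · subst h; exact Commute.refl _
  · exact site_comm h _ _

theorem zzOp_commute (k i j : ℕ) : Commute (zzOp k i) (zzOp k j) := by
  have h := site_matσz_commute k
  cases i <;> cases j <;> simp only [zzOp]
  · exact h _ _
  · exact (h _ _).mul_right (h _ _)
  · exact (h _ _).mul_left (h _ _)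
  · exact ((h _ _).mul_right (h _ _)).mul_left ((h _ _).mul_right (h _ _))

theorem site_matσz_sq (n p : ℕ) :
    (site p matσz * site p matσz : Module.End ℂ (Qubits n)) = 1 := by
  rw [site_mul, matσz_sq, site_one]

theorem zzOp_sq (k j : ℕ) : zzOp k j * zzOp k j = 1 := by
  cases j with
  | zero => exact site_matσz_sq _ _
  | succ j =>
    simp only [zzOp]
    rw [(site_matσz_commute k (j + 1) j).mul_mul_mul_comm, site_matσz_sq, site_matσz_sq, one_mul]

theorem zzOp_commute_site {k j l : ℕ} (h1 : l ≠ j) (h2 : l + 1 ≠ j) :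
    Commute (zzOp k j) (site l matS) := by
  cases j with
  | zero => exact site_comm (by omega) _ _
  | succ j =>
    have a : Commute (site j matσz : Module.End ℂ (Qubits k)) (site l matS) :=
      site_comm (by omega) _ _
    have b : Commute (site (j + 1) matσz : Module.End ℂ (Qubits k)) (site l matS) :=
      site_comm (by omega) _ _
    exact a.mul_left b

theorem site_matσz_anti {k l : ℕ} (hl : l < k) :
    (site l matσz * site l matS : Module.End ℂ (Qubits k)) = -(site l matS * site l matσz) := by
  rw [site_mul, site_mul, matσz_mul_matS, site_neg hl]

theorem zzOp_anti_site {k l j : ℕ} (hl : l < k) (hj : l = j ∨ l + 1 = j) :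
    zzOp k j * site l matS = -(site l matS * zzOp k j) := by
  have ha := site_matσz_anti hl
  rcases hj with rfl | rfl
  · cases l with
    | zero => exact ha
    | succ l =>
      have hc := site_comm (n := k) (show l ≠ l + 1 by omega) matσz matS
      simp only [zzOp]
      rw [mul_assoc, ha, mul_neg, ← mul_assoc, hc, mul_assoc]
  · have hc := site_comm (n := k) (show l + 1 ≠ l by omega) matσz matS
    simp only [zzOp]
    rw [mul_assoc, hc, ← mul_assoc, ha, neg_mul, mul_assoc]

theorem rhoOp_odd (k j : ℕ) : rhoOp k (2 * j + 1) = site j matS := by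
  simp [rhoOp]

theorem rhoOp_even (k j : ℕ) : rhoOp k (2 * j) = Complex.I • zzOp k j := by
  cases j with
  | zero => simp [rhoOp, zzOp]
  | succ j =>
    have h : ¬ Even (2 * j + 1) := by simp
    have h' : (2 * j + 1) / 2 = j := by omega
    rw [show 2 * (j + 1) = (2 * j + 1) + 1 by ring]
    simp only [rhoOp, zzOp, if_neg h, h']

theorem lambdaOp_odd {k j : ℕ} (ε : ℤˣ) (hj : j < k) :
    lambdaOp k ε (2 * j + 1) = site j matS := by
  rw [lambdaOp, if_pos (by omega), rhoOp_odd]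

theorem lambdaOp_last (k : ℕ) (ε : ℤˣ) :
    lambdaOp k ε (2 * k) = (((ε : ℤ) : ℂ) * Complex.I) • zzOp k k := by
  rw [lambdaOp, if_neg (by omega)]
  cases k with
  | zero => simp [zzOp, site_of_le]
  | succ k => simp [zzOp, site_of_le]

theorem lambdaOp_even {k j : ℕ} (ε : ℤˣ) (hj : j ≤ k) :
    ∃ c : ℂ, c * c = -1 ∧ lambdaOp k ε (2 * j) = c • zzOp k j := by
  rcases hj.lt_or_eq with hj | rfl
  · exact ⟨Complex.I, Complex.I_mul_I, by rw [lambdaOp, if_pos (by omega), rhoOp_even]⟩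
  · refine ⟨_, ?_, lambdaOp_last j ε⟩
    rcases Int.units_eq_one_or ε with rfl | rfl <;> simp

theorem lambdaOp_extraspecialRelations (k : ℕ) (ε : ℤˣ) :
    ExtraspecialRelations (2 * k + 1) (lambdaOp k ε) where
  sq i hi := by
    obtain ⟨j, rfl | rfl⟩ : ∃ j, i = 2 * j ∨ i = 2 * j + 1 := ⟨i / 2, by omega⟩
    · obtain ⟨c, hc, h⟩ := lambdaOp_even ε (show j ≤ k by omega)
      rw [h, smul_mul_smul_comm, hc, zzOp_sq, neg_one_smul]
    · rw [lambdaOp_odd ε (by omega), site_mul, matS_sq, site_neg (by omega), site_one]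
  far i i' hij hi' := by
    obtain ⟨j, rfl | rfl⟩ : ∃ j, i = 2 * j ∨ i = 2 * j + 1 := ⟨i / 2, by omega⟩ <;>
    obtain ⟨j', rfl | rfl⟩ : ∃ j, i' = 2 * j ∨ i' = 2 * j + 1 := ⟨i' / 2, by omega⟩
    · obtain ⟨c, -, h⟩ := lambdaOp_even ε (show j ≤ k by omega)
      obtain ⟨c', -, h'⟩ := lambdaOp_even ε (show j' ≤ k by omega)
      rw [h, h']
      exact (((zzOp_commute k j j').smul_left c).smul_right c').eq
    · obtain ⟨c, -, h⟩ := lambdaOp_even ε (show j ≤ k by omega)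
      rw [h, lambdaOp_odd ε (by omega)]
      exact ((zzOp_commute_site (by omega) (by omega)).smul_left c).eq
    · obtain ⟨c, -, h⟩ := lambdaOp_even ε (show j' ≤ k by omega)
      rw [h, lambdaOp_odd ε (by omega)]
      exact ((zzOp_commute_site (by omega) (by omega)).smul_left c).eq.symm
    · rw [lambdaOp_odd ε (by omega), lambdaOp_odd ε (by omega)]
      exact site_comm (by omega) _ _
  anti i hi := by
    obtain ⟨j, rfl | rfl⟩ : ∃ j, i = 2 * j ∨ i = 2 * j + 1 := ⟨i / 2, by omega⟩
    · obtain ⟨c, -, h⟩ := lambdaOp_even ε (show j ≤ k by omega)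
      rw [h, lambdaOp_odd ε (by omega), mul_smul_comm, smul_mul_assoc,
        zzOp_anti_site (by omega) (Or.inl rfl), smul_neg, neg_neg]
    · obtain ⟨c, -, h⟩ := lambdaOp_even ε (show j + 1 ≤ k by omega)
      rw [show 2 * j + 1 + 1 = 2 * (j + 1) by ring, h, lambdaOp_odd ε (by omega), mul_smul_comm,
        smul_mul_assoc, zzOp_anti_site (by omega) (Or.inr rfl), smul_neg]

theorem rhoOp_extraspecialRelations (k : ℕ) : ExtraspecialRelations (2 * k) (rhoOp k) := by
  have e : ∀ i < 2 * k, rhoOp k i = lambdaOp k 1 i := fun i hi => by rw [lambdaOp, if_pos hi]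
  have h := lambdaOp_extraspecialRelations k 1
  refine ⟨fun i hi => ?_, fun i j hij hj => ?_, fun i hi => ?_⟩
  · rw [e i hi]; exact h.sq i (by omega)
  · rw [e i (by omega), e j hj]; exact h.far i j hij (by omega)
  · rw [e i (by omega), e (i + 1) hi]; exact h.anti i (by omega)

theorem matd_eq : matd = (((√2 : ℝ) : ℂ)⁻¹) • (1 + Complex.I • matσz) := by
  ext i j
  fin_cases i <;> fin_cases j <;> simp [matd, matσz, zeta8, zeta8bar_eq, sub_eq_add_neg]

theorem matdbar_eq : matdbar = (((√2 : ℝ) : ℂ)⁻¹) • (1 + (-Complex.I) • matσz) := by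
  ext i j
  fin_cases i <;> fin_cases j <;> simp [matdbar, matσz, zeta8, zeta8bar_eq, sub_eq_add_neg]

theorem matM_eq : matM = (((√2 : ℝ) : ℂ)⁻¹) • (1 + (1 : ℂ) • matS) := by
  ext i j
  fin_cases i <;> fin_cases j <;> simp [matM, matS]

theorem rhoHatOp_eq {k i : ℕ} (hi : i < 2 * k) :
    rhoHatOp k i = (((√2 : ℝ) : ℂ)⁻¹) • (1 + rhoOp k i) := by
  cases i with
  | zero => rw [rhoHatOp, rhoOp, matd_eq, site_smul_add (by omega)]
  | succ i =>
    by_cases h : Even i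
    · rw [rhoHatOp, rhoOp, if_pos h, if_pos h, matM_eq, site_smul_add (by omega), one_smul]
    · have : i / 2 + 1 < k := by
        rw [Nat.not_even_iff] at h
        omega
      rw [rhoHatOp, rhoOp, if_neg h, if_neg h, sitePair_matD this]

theorem lambdaHatOp_eq {k i : ℕ} (ε : ℤˣ) :
    lambdaHatOp k ε i = (((√2 : ℝ) : ℂ)⁻¹) • (1 + lambdaOp k ε i) := by
  by_cases hi : i < 2 * k
  · rw [lambdaHatOp, lambdaOp, if_pos hi, if_pos hi, rhoHatOp_eq hi]
  rw [lambdaHatOp, lambdaOp, if_neg hi, if_neg hi]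
  have hne : (-1 : ℤˣ) ≠ 1 := by decide
  by_cases hk : k = 0
  · rcases Int.units_eq_one_or ε with rfl | rfl
    · simp [hk, zeta8, mul_smul, add_smul]
    · simp [hk, hne, zeta8bar_eq, mul_smul, sub_eq_add_neg, add_smul]
  · rcases Int.units_eq_one_or ε with rfl | rfl
    · rw [if_neg hk, if_neg hk, if_pos rfl, matd_eq, site_smul_add (by omega)]
      simp
    · rw [if_neg hk, if_neg hk, if_neg hne, matdbar_eq, site_smul_add (by omega)]
      simp

theorem rhoHatOp_braidRelations (k : ℕ) : BraidRelations (2 * k + 1) (rhoHatOp k) :=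
  ExtraspecialRelations.braidRelations (n := 2 * k + 1) (rhoOp_extraspecialRelations k)
    fun _ hi => rhoHatOp_eq hi

theorem lambdaHatOp_braidRelations (k : ℕ) (ε : ℤˣ) :
    BraidRelations (2 * k + 2) (lambdaHatOp k ε) :=
  ExtraspecialRelations.braidRelations (n := 2 * k + 2) (lambdaOp_extraspecialRelations k ε)
    fun _ _ => lambdaHatOp_eq ε

/-- The representation `(ρ₁, V₁)` of the extraspecial group on `2 k` generators, with
`V₁ = (ℂ²)^{⊗ k}`. -/
noncomputable def rho (k : ℕ) : Representation ℂ (NearlyExtraspecial (2 * k)) (Qubits k) :=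
  extraspecialRep (rhoOp_extraspecialRelations k)

/-- The representations `(λ₁, W₁)` (for `ε = 1`) and `(λ₂, W₂)` (for `ε = -1`) of the nearly
extraspecial group on `2 k + 1` generators, with `W₁ = W₂ = (ℂ²)^{⊗ k}` as vector spaces. -/
noncomputable def lambda (k : ℕ) (ε : ℤˣ) :
    Representation ℂ (NearlyExtraspecial (2 * k + 1)) (Qubits k) :=
  extraspecialRep (lambdaOp_extraspecialRelations k ε)

/-- The representation `ρ̂₁` of the braid group on `2 k + 1` strands on `V₁`. -/
noncomputable def rhoHat (k : ℕ) : Representation ℂ (BraidGroup (2 * k + 1)) (Qubits k) :=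
  braidRep (rhoHatOp_braidRelations k)

/-- The representations `λ̂₁` (for `ε = 1`) and `λ̂₂` (for `ε = -1`) of the braid group on
`2 k + 2` strands on `W₁` and `W₂`. -/
noncomputable def lambdaHat (k : ℕ) (ε : ℤˣ) :
    Representation ℂ (BraidGroup (2 * k + 2)) (Qubits k) :=
  braidRep (lambdaHatOp_braidRelations k ε)

/-- The restriction to the pure braid group of a representation of the braid group. -/
def restrictPure {n : ℕ} {V : Type*} [AddCommGroup V] [Module ℂ V]
    (ρ : Representation ℂ (BraidGroup n) V) : Representation ℂ (PureBraidGroup n) V :=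
  MonoidHom.comp ρ (PureBraidGroup n).subtype

/-- The pullback of a representation along a group homomorphism. -/
def pullback {G H V : Type*} [Group G] [Group H] [AddCommGroup V] [Module ℂ V]
    (ρ : Representation ℂ H V) (f : G →* H) : Representation ℂ G V :=
  MonoidHom.comp ρ f

/-! The Yang–Baxter operator is `(1 + s ⊗ σ_x) / √2`. Put `J i = s ⊗ σ_x` on the factors `i`, `i +
1`. These operators have square `-1`, anticommute when neighbouring and commute otherwise, and each
braid generator acts as `(1 + J i) / √2`. Since `((1 + J i) / √2) ^ 2 = J i`, the braid generators
and the operators `J i` have the same invariant subspaces and the same intertwiners. The operators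
defining `ρ̂₁`, `λ̂₁`, `λ̂₂` arise in the same way from those defining `ρ₁`, `λ₁`, `λ₂`. The
decomposition is therefore a question about vector spaces with families of operators satisfying
`ExtraspecialRelations`.

An even number `2 k` of such operators is determined up to isomorphism by the dimension of the space
(`exists_linearEquiv`). Indeed, the second operator exchanges the two eigenspaces of the first, and
the remaining `2 k - 2` operators act on one of them with the same relations. By the same induction
the dimension is a multiple of `2 ^ k` (`two_pow_dvd_finrank`), so a space of dimension `2 ^ k` is
irreducible. For an odd number of operators the dimension is not enough, because there are two
irreducible types, which differ by the sign of the last operator. Here one more operator, exchanging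
the two types, is appended; this reduces to the even case and accounts for the sum `W₁ ⊕ W₂`.

For pure braids, conjugation by `(1 + J i) / √2` preserves the group generated by the `J i`, and
this group contains the squares of the braid generators. A homomorphism from the braid group which
kills the squares of the generators kills all pure braids (`eq_one_of_mem_pureBraidGroup`), since
the Coxeter relations already present the symmetric group. So pure braids act through the group
generated by the `J i`, and `qubitRep_injective` identifies that group with the abstract nearly
extraspecial group, which gives `θ`. -/

/-! ## Pure braids and products of squares -/

section Coxeter

variable {G : Type*} [Group G]

/-- The product `g m * g (m - 1) * ⋯` with `l` factors. -/
def descendingProd (g : ℕ → G) (m : ℕ) : ℕ → G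
  | 0 => 1
  | l + 1 => descendingProd g m l * g (m - l)

/-- The factors have indices from `m` down to `m - l + 1`, and all of them differ from `i` by at
least two. -/
theorem descendingProd_mul_of_lt {g : ℕ → G} {n m : ℕ} (hm : m < n)
    (hfar : ∀ i j, i + 2 ≤ j → j < n → g i * g j = g j * g i) :
    ∀ l ≤ m + 1, ∀ i, i + l < m →
      descendingProd g m l * g i = g i * descendingProd g m l
  | 0, _, i, _ => by simp [descendingProd]
  | l + 1, hl, i, hi => by
    rw [descendingProd, mul_assoc, ← hfar i (m - l) (by omega) (by omega), ← mul_assoc,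
      descendingProd_mul_of_lt hm hfar l (by omega) i (by omega), mul_assoc]

/-- Both `i + 1` and `i` occur among the indices of the factors. Moving left, `g (i + 1)` passes the
factors of index below `i`; the braid relation then turns `g (i + 1) * g i * g (i + 1)` into `g i *
g (i + 1) * g i`, and the leading `g i` passes the factors of index above `i + 1`. -/
theorem descendingProd_mul_of_gt {g : ℕ → G} {n m : ℕ} (hm : m < n)
    (hfar : ∀ i j, i + 2 ≤ j → j < n → g i * g j = g j * g i)
    (hbraid : ∀ i, i + 1 < n → g i * g (i + 1) * g i = g (i + 1) * g i * g (i + 1)) :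
    ∀ l ≤ m + 1, ∀ i < m, m < i + l →
      descendingProd g m l * g (i + 1) = g i * descendingProd g m l
  | 0, _, i, hi, hil => by omega
  | l + 1, hl, i, hi, hil => by
    rcases Nat.lt_or_ge m (i + l) with h | h
    · rw [descendingProd, mul_assoc, hfar (m - l) (i + 1) (by omega) (by omega), ← mul_assoc,
        descendingProd_mul_of_gt hm hfar hbraid l (by omega) i hi h, mul_assoc]
    · obtain ⟨l, rfl⟩ : ∃ l', l = l' + 1 := ⟨l - 1, by omega⟩
      have e1 : m - (l + 1) = i := by omega
      have e2 : m - l = i + 1 := by omega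
      have hc := descendingProd_mul_of_lt hm hfar l (by omega) i (by omega)
      rw [descendingProd, descendingProd, e1, e2]
      calc descendingProd g m l * g (i + 1) * g i * g (i + 1)
          = descendingProd g m l * (g (i + 1) * g i * g (i + 1)) := by group
        _ = (descendingProd g m l * g i) * g (i + 1) * g i := by
          rw [← hbraid i (by omega)]; group
        _ = g i * (descendingProd g m l * g (i + 1) * g i) := by rw [hc]; group

/-- In a group generated by elements with the relations of the symmetric group, the cosets of the
subgroup which omits the last generator are represented by descending products. -/
theorem exists_eq_mul_descendingProd {g : ℕ → G} {n m : ℕ} (hm : m < n)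
    (hfar : ∀ i j, i + 2 ≤ j → j < n → g i * g j = g j * g i)
    (hbraid : ∀ i, i + 1 < n → g i * g (i + 1) * g i = g (i + 1) * g i * g (i + 1))
    (hsq : ∀ i < n, g i * g i = 1) {x : G}
    (hx : x ∈ Subgroup.closure (g '' Set.Iio (m + 1))) :
    ∃ h ∈ Subgroup.closure (g '' Set.Iio m), ∃ l ≤ m + 1, x = h * descendingProd g m l := by
  have step : ∀ x : G, (∃ h ∈ Subgroup.closure (g '' Set.Iio m), ∃ l ≤ m + 1,
      x = h * descendingProd g m l) → ∀ i < m + 1,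
      ∃ h ∈ Subgroup.closure (g '' Set.Iio m), ∃ l ≤ m + 1,
        x * g i = h * descendingProd g m l := by
    rintro x ⟨h, hh, l, hl, rfl⟩ i hi
    have hmem : ∀ j < m, g j ∈ Subgroup.closure (g '' Set.Iio m) := fun j hj =>
      Subgroup.subset_closure ⟨j, hj, rfl⟩
    -- The last factor of the product has index `m - l + 1`. For `i < m - l` the new factor passes
    -- through unchanged; for `i = m - l` it lengthens the product; for `i = m - l + 1` it cancels
    -- the last factor; for larger `i` it emerges on the left with its index lowered by one.
    rcases lt_trichotomy (i + l) m with h1 | h1 | h1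
    · refine ⟨h * g i, mul_mem hh (hmem i (by omega)), l, hl, ?_⟩
      rw [mul_assoc, descendingProd_mul_of_lt hm hfar l hl i h1, mul_assoc]
    · refine ⟨h, hh, l + 1, by omega, ?_⟩
      rw [descendingProd, show m - l = i by omega, mul_assoc]
    · rcases Nat.lt_or_ge (m + 1) (i + l) with h2 | h2
      · obtain ⟨i, rfl⟩ : ∃ i', i = i' + 1 := ⟨i - 1, by omega⟩
        refine ⟨h * g i, mul_mem hh (hmem i (by omega)), l, hl, ?_⟩
        rw [mul_assoc, descendingProd_mul_of_gt hm hfar hbraid l hl i (by omega) (by omega),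
          mul_assoc]
      · obtain ⟨l, rfl⟩ : ∃ l', l = l' + 1 := ⟨l - 1, by omega⟩
        refine ⟨h, hh, l, by omega, ?_⟩
        rw [descendingProd, show m - l = i by omega, mul_assoc, mul_assoc, hsq i (by omega),
          mul_one]
  induction hx using Subgroup.closure_induction_right with
  | one => exact ⟨1, one_mem _, 0, by omega, by simp [descendingProd]⟩
  | mul_right x _ y hy ih =>
    obtain ⟨i, hi, rfl⟩ := hy
    exact step x ih i hi
  | mul_inv_cancel x _ y hy ih =>
    obtain ⟨i, hi, rfl⟩ := hy
    rw [inv_eq_of_mul_eq_one_left (hsq i (lt_of_lt_of_le hi hm))]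
    exact step x ih i hi

end Coxeter

theorem adjSwap_apply_of_lt {n : ℕ} (i : Fin (n - 1)) (p : Fin n) (h : (i : ℕ) + 1 < p) :
    adjSwap i p = p := by
  refine Equiv.swap_apply_of_ne_of_ne ?_ ?_ <;> simp [Fin.ext_iff] <;> omega

/-- A homomorphism from the braid group which sends the generators to elements of order two is
trivial on pure braids. -/
theorem eq_one_of_mem_pureBraidGroup {n : ℕ} {Q : Type*} [Group Q] (f : BraidGroup n →* Q)
    (hf : ∀ i : Fin (n - 1), f (BraidGroup.σ i) * f (BraidGroup.σ i) = 1)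
    {b : BraidGroup n} (hb : b ∈ PureBraidGroup n) : f b = 1 := by
  -- The images under `F` satisfy the Coxeter relations of the symmetric group. It is enough that an
  -- element of the group they generate is trivial as soon as its permutation is; this avoids
  -- counting the elements of the abstract Coxeter group.
  let F : BraidGroup n →* Q × Equiv.Perm (Fin n) := f.prod (BraidGroup.toPerm n)
  let g : ℕ → Q × Equiv.Perm (Fin n) := fun i =>
    if h : i < n - 1 then F (BraidGroup.σ ⟨i, h⟩) else 1
  have hg : ∀ i (h : i < n - 1), g i = F (BraidGroup.σ ⟨i, h⟩) := fun i h => dif_pos h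
  have hg2 : ∀ i (h : i < n - 1), (g i).2 = adjSwap ⟨i, h⟩ := fun i h => by
    rw [hg i h]; simp [F, BraidGroup.toPerm, BraidGroup.lift_σ]
  have hfar : ∀ i j, i + 2 ≤ j → j < n - 1 → g i * g j = g j * g i := by
    intro i j hij hj
    rw [hg i (by omega), hg j hj, ← map_mul, ← map_mul]
    congr 1
    exact PresentedGroup.mk_eq_mk_of_mul_inv_mem (BraidRel.far _ _ hij)
  have hbraid : ∀ i, i + 1 < n - 1 → g i * g (i + 1) * g i = g (i + 1) * g i * g (i + 1) := by
    intro i hi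
    rw [hg i (by omega), hg (i + 1) hi]
    simp only [← map_mul]
    congr 1
    exact PresentedGroup.mk_eq_mk_of_mul_inv_mem
      (BraidRel.braid (⟨i, by omega⟩ : Fin (n - 1)) ⟨i + 1, hi⟩ rfl)
  have hsq : ∀ i < n - 1, g i * g i = 1 := by
    intro i hi
    refine Prod.ext ?_ ?_
    · rw [hg i hi]; exact hf ⟨i, hi⟩
    · rw [Prod.snd_mul, hg2 i hi]; exact Equiv.swap_mul_self _ _
  have hfix : ∀ m ≤ n - 1, ∀ x ∈ Subgroup.closure (g '' Set.Iio m), ∀ p : Fin n, m < p →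
      x.2 p = p := by
    intro m hm x hx p hp
    have : Subgroup.closure (g '' Set.Iio m) ≤
        (MulAction.stabilizer (Equiv.Perm (Fin n)) p).comap (MonoidHom.snd _ _) := by
      rw [Subgroup.closure_le]
      rintro _ ⟨i, hi, rfl⟩
      rw [Set.mem_Iio] at hi
      change (g i).2 p = p
      rw [hg2 i (by omega)]
      exact adjSwap_apply_of_lt _ _ (by simp only; omega)
    exact this hx
  -- The rightmost transposition acts first, so the point `m + 1 - l` is carried upwards one place
  -- at a time.
  have hmove : ∀ m (hm : m < n - 1), ∀ l, ∀ hl : l ≤ m + 1,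
      (descendingProd g m l).2 ⟨m + 1 - l, by omega⟩ = ⟨m + 1, by omega⟩ := by
    intro m hm l
    induction l with
    | zero => intro _; simp [descendingProd]
    | succ l ih =>
      intro hl
      rw [descendingProd, Prod.snd_mul, hg2 (m - l) (by omega), Equiv.Perm.mul_apply]
      have : adjSwap (⟨m - l, by omega⟩ : Fin (n - 1)) ⟨m + 1 - (l + 1), by omega⟩ =
          ⟨m + 1 - l, by omega⟩ := by
        have e : (⟨m + 1 - (l + 1), by omega⟩ : Fin n) = ⟨m - l, by omega⟩ := by
          ext; simp only; omega
        rw [e, adjSwap, Equiv.swap_apply_left]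
        ext; simp only; omega
      rw [this, ih (by omega)]
  have main : ∀ m ≤ n - 1, ∀ x ∈ Subgroup.closure (g '' Set.Iio m), x.2 = 1 → x = 1 := by
    intro m
    induction m with
    | zero =>
      intro _ x hx _
      simpa using hx
    | succ m ih =>
      intro hm x hx hx2
      obtain ⟨h, hh, l, hl, rfl⟩ := exists_eq_mul_descendingProd (by omega) hfar hbraid hsq hx
      rcases Nat.eq_zero_or_pos l with rfl | hl0
      · simp only [descendingProd, mul_one] at hx2 ⊢
        exact ih (by omega) h hh hx2
      -- The element `h` fixes `m + 1`, so the product sends `m + 1 - l` to `m + 1`. For `l > 0` its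
      -- permutation cannot be trivial.
      · exfalso
        have e := hfix m (by omega) h hh ⟨m + 1, by omega⟩ (by simp)
        rw [← hmove m (by omega) l hl, ← Equiv.Perm.mul_apply, ← Prod.snd_mul, hx2,
          hmove m (by omega) l hl] at e
        simp [Fin.ext_iff] at e
        omega
  have hF : F b ∈ Subgroup.closure (g '' Set.Iio (n - 1)) := by
    have : (⊤ : Subgroup (BraidGroup n)) ≤ (Subgroup.closure (g '' Set.Iio (n - 1))).comap F := by
      rw [← PresentedGroup.closure_range_of, Subgroup.closure_le]
      rintro _ ⟨i, rfl⟩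
      exact Subgroup.subset_closure ⟨i, i.2, hg i i.2⟩
    exact this (Subgroup.mem_top b)
  exact congrArg Prod.fst (main (n - 1) le_rfl (F b) hF hb)

/-- If the generators of the braid group act through elements which normalize a subgroup and whose
squares belong to it, then the pure braids act through elements of this subgroup. -/
theorem map_mem_of_mem_pureBraidGroup {n : ℕ} {G : Type*} [Group G] (f : BraidGroup n →* G)
    (N : Subgroup G) (hf : ∀ i, f (BraidGroup.σ i) ∈ Subgroup.normalizer (N : Set G))
    (hsq : ∀ i, f (BraidGroup.σ i) * f (BraidGroup.σ i) ∈ N)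
    {b : BraidGroup n} (hb : b ∈ PureBraidGroup n) : f b ∈ N := by
  have hmem : ∀ b, f b ∈ Subgroup.normalizer (N : Set G) := by
    intro b
    have : (⊤ : Subgroup (BraidGroup n)) ≤ (Subgroup.normalizer (N : Set G)).comap f := by
      rw [← PresentedGroup.closure_range_of, Subgroup.closure_le]
      rintro _ ⟨i, rfl⟩
      exact hf i
    exact this (Subgroup.mem_top b)
  -- In the quotient of the normalizer by `N` the generators have trivial square, so the preceding
  -- theorem applies to `q`.
  let q := (QuotientGroup.mk' (N.subgroupOf (Subgroup.normalizer (N : Set G)))).comp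
    (f.codRestrict _ hmem)
  have h1 : q b = 1 := by
    refine eq_one_of_mem_pureBraidGroup q (fun i => ?_) hb
    rw [← map_mul]
    refine (QuotientGroup.eq_one_iff _).2 ?_
    rw [Subgroup.mem_subgroupOf]
    simpa using hsq i
  have h2 := (QuotientGroup.eq_one_iff _).1 h1
  rw [Subgroup.mem_subgroupOf] at h2
  exact h2

/-! ## Vector spaces with operators which satisfy the relations of an extraspecial group -/

namespace ExtraspecialRelations

section Ring

variable {A B : Type*} [Ring A] [Ring B] {m : ℕ} {J : ℕ → A}

theorem map (h : ExtraspecialRelations m J) {F : Type*} [FunLike F A B] [RingHomClass F A B]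
    (f : F) : ExtraspecialRelations m fun i => f (J i) where
  sq i hi := by rw [← map_mul, h.sq i hi, map_neg, map_one]
  far i j hij hj := by rw [← map_mul, h.far i j hij hj, map_mul]
  anti i hi := by rw [← map_mul, h.anti i hi, map_neg, map_mul]

/-- Append an operator which anticommutes with the last operator and commutes with the others. -/
theorem snoc (h : ExtraspecialRelations (m + 1) J) {C : A} (hsq : C * C = -1)
    (hcomm : ∀ i < m, J i * C = C * J i) (hanti : C * J m = -(J m * C)) :
    ExtraspecialRelations (m + 2) (fun i => if i < m + 1 then J i else C) where
  sq i hi := by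
    split_ifs with h1
    · exact h.sq i h1
    · exact hsq
  far i j hij hj := by
    rw [if_pos (by omega)]
    split_ifs with h1
    · exact h.far i j hij h1
    · exact hcomm i (by omega)
  anti i hi := by
    rw [if_pos (show i < m + 1 by omega)]
    split_ifs with h1
    · exact h.anti i h1
    · obtain rfl : i = m := by omega
      exact hanti

end Ring

/-! ### Splitting off the first two operators -/

section Split

variable {V W : Type*} [AddCommGroup V] [Module ℂ V] [AddCommGroup W] [Module ℂ W]

theorem sq_apply {m : ℕ} {J : ℕ → Module.End ℂ V} (h : ExtraspecialRelations m J) {i : ℕ}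
    (hi : i < m) (v : V) : J i (J i v) = -v :=
  congrArg (fun f : Module.End ℂ V => f v) (h.sq i hi)

theorem far_apply {m : ℕ} {J : ℕ → Module.End ℂ V} (h : ExtraspecialRelations m J) {i j : ℕ}
    (hij : i + 2 ≤ j) (hj : j < m) (v : V) : J i (J j v) = J j (J i v) :=
  congrArg (fun f : Module.End ℂ V => f v) (h.far i j hij hj)

theorem anti_apply {m : ℕ} {J : ℕ → Module.End ℂ V} (h : ExtraspecialRelations m J) {i : ℕ}
    (hi : i + 1 < m) (v : V) : J (i + 1) (J i v) = -J i (J (i + 1) v) :=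
  congrArg (fun f : Module.End ℂ V => f v) (h.anti i hi)

/-- The projection onto the eigenspace of the first operator with eigenvalue `√-1`. -/
noncomputable def proj {m : ℕ} {J : ℕ → Module.End ℂ V} (h : ExtraspecialRelations (m + 2) J) :
    V →ₗ[ℂ] (J 0).eigenspace Complex.I :=
  LinearMap.codRestrict _ ((1 / 2 : ℂ) • (1 - Complex.I • J 0)) fun v => by
    rw [Module.End.mem_eigenspace_iff]
    simp only [LinearMap.smul_apply, LinearMap.sub_apply, Module.End.one_apply, map_smul, map_sub,
      h.sq_apply (show 0 < m + 2 by omega), smul_sub, smul_neg, smul_smul]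
    match_scalars <;> first | ring1 | linear_combination ((1 / 2 : ℂ) * Complex.I_mul_I)

theorem proj_coe {m : ℕ} {J : ℕ → Module.End ℂ V} (h : ExtraspecialRelations (m + 2) J) (v : V) :
    (h.proj v : V) = (1 / 2 : ℂ) • (v - Complex.I • J 0 v) := rfl

theorem apply_coe {J : ℕ → Module.End ℂ V} (a : (J 0).eigenspace Complex.I) :
    J 0 a = Complex.I • (a : V) := Module.End.mem_eigenspace_iff.1 a.2

/-- The operators after the first two, restricted to the eigenspace of the first one. -/
noncomputable def restr {m : ℕ} {J : ℕ → Module.End ℂ V} (h : ExtraspecialRelations (m + 2) J)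
    (i : ℕ) : Module.End ℂ ((J 0).eigenspace Complex.I) :=
  if hi : i < m then (J (i + 2)).restrict fun v hv => by
    rw [Module.End.mem_eigenspace_iff] at hv ⊢
    rw [h.far_apply (by omega) (by omega), hv, map_smul]
  else 0

theorem restr_coe {m : ℕ} {J : ℕ → Module.End ℂ V} (h : ExtraspecialRelations (m + 2) J)
    {i : ℕ} (hi : i < m) (a : (J 0).eigenspace Complex.I) :
    (h.restr i a : V) = J (i + 2) a := by
  simp [restr, hi]

theorem restr_extraspecialRelations {m : ℕ} {J : ℕ → Module.End ℂ V}
    (h : ExtraspecialRelations (m + 2) J) : ExtraspecialRelations m h.restr where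
  sq i hi := by
    ext a
    simp [h.restr_coe hi, h.sq_apply (show i + 2 < m + 2 by omega)]
  far i j hij hj := by
    ext a
    simp [h.restr_coe (show i < m by omega), h.restr_coe hj,
      h.far_apply (show i + 2 + 2 ≤ j + 2 by omega) (show j + 2 < m + 2 by omega)]
  anti i hi := by
    ext a
    simp only [Module.End.mul_apply, LinearMap.neg_apply, Submodule.coe_neg,
      h.restr_coe (show i < m by omega), h.restr_coe hi]
    exact h.anti_apply (show i + 2 + 1 < m + 2 by omega) _

theorem proj_coe_self {m : ℕ} {J : ℕ → Module.End ℂ V} (h : ExtraspecialRelations (m + 2) J)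
    (a : (J 0).eigenspace Complex.I) : h.proj a = a := by
  ext
  rw [h.proj_coe, apply_coe]
  match_scalars
  linear_combination (-(1 / 2 : ℂ) * Complex.I_mul_I)

/-- As `J 1` anticommutes with `J 0`, it maps the eigenspace for `√-1` into the one for `-√-1`,
which is the kernel of the projection. -/
theorem proj_apply_one_coe {m : ℕ} {J : ℕ → Module.End ℂ V}
    (h : ExtraspecialRelations (m + 2) J)
    (a : (J 0).eigenspace Complex.I) : h.proj (J 1 a) = 0 := by
  ext
  have e := h.anti_apply (show 0 + 1 < m + 2 by omega) (a : V)
  rw [zero_add, apply_coe, map_smul] at e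
  rw [h.proj_coe, ← neg_eq_iff_eq_neg.2 e, Submodule.coe_zero]
  match_scalars
  linear_combination ((1 / 2 : ℂ) * Complex.I_mul_I)

/-- The decomposition of the space into the eigenspace of the first operator and its image under
the second one. -/
noncomputable def split {m : ℕ} {J : ℕ → Module.End ℂ V} (h : ExtraspecialRelations (m + 2) J) :
    V ≃ₗ[ℂ] (J 0).eigenspace Complex.I × (J 0).eigenspace Complex.I where
  __ := h.proj.prod (h.proj ∘ₗ J 1)
  -- The minus sign compensates `J 1 * J 1 = -1`: the second coordinate of `v` is the projection of
  -- `J 1 v`.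
  invFun p := p.1 - J 1 p.2
  left_inv v := by
    have e1 := h.anti_apply (show 0 + 1 < m + 2 by omega) (J 1 v)
    rw [zero_add, h.sq_apply (show 1 < m + 2 by omega), map_neg, neg_neg] at e1
    change (1 / 2 : ℂ) • (v - Complex.I • J 0 v) -
      J 1 ((1 / 2 : ℂ) • (J 1 v - Complex.I • J 0 (J 1 v))) = v
    rw [map_smul, map_sub, map_smul, e1, h.sq_apply (by omega)]
    module
  right_inv p := by
    have e1 : J 1 (J 1 (p.2 : V)) = -(p.2 : V) := h.sq_apply (by omega) _
    simp [h.proj_coe_self, h.proj_apply_one_coe, e1]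

theorem split_symm_apply {m : ℕ} {J : ℕ → Module.End ℂ V} (h : ExtraspecialRelations (m + 2) J)
    (p : (J 0).eigenspace Complex.I × (J 0).eigenspace Complex.I) :
    h.split.symm p = p.1 - J 1 p.2 := rfl

theorem finrank_eq {m : ℕ} {J : ℕ → Module.End ℂ V} (h : ExtraspecialRelations (m + 2) J)
    [FiniteDimensional ℂ V] :
    Module.finrank ℂ V = 2 * Module.finrank ℂ ((J 0).eigenspace Complex.I) := by
  rw [h.split.finrank_eq, Module.finrank_prod, two_mul]

/-- The restricted operators determine all of them. In the coordinates `(a, b)` of `a - J 1 b`, the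
operator `J 0` is `(√-1 a, -√-1 b)` and `J 1` is `(b, -a)`. Writing `r i` for `h.restr i`, `J 2` is
`(r 0 a, -r 0 b)`, since it anticommutes with `J 1`, and `J (i + 3)` is `(r (i + 1) a, r (i + 1)
b)`. Hence `f`, applied to both coordinates, intertwines the families. -/
theorem exists_linearEquiv_of_restr {m : ℕ} {J : ℕ → Module.End ℂ V} {K : ℕ → Module.End ℂ W}
    (h : ExtraspecialRelations (m + 2) J) (h' : ExtraspecialRelations (m + 2) K)
    (f : (J 0).eigenspace Complex.I ≃ₗ[ℂ] (K 0).eigenspace Complex.I)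
    (hf : ∀ i < m, ∀ a, f (h.restr i a) = h'.restr i (f a)) :
    ∃ e : V ≃ₗ[ℂ] W, ∀ i < m + 2, ∀ v, e (J i v) = K i (e v) := by
  refine ⟨h.split.trans ((f.prodCongr f).trans h'.split.symm), fun i hi v => ?_⟩
  obtain ⟨⟨a, b⟩, rfl⟩ := h.split.symm.surjective v
  have key : ∀ a b : (J 0).eigenspace Complex.I,
      (h.split.trans ((f.prodCongr f).trans h'.split.symm)) ((a : V) - J 1 (b : V)) =
        (f a : W) - K 1 (f b : W) := by
    intro a b
    have := h.split_symm_apply (a, b)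
    simp only at this
    rw [← this]
    simp [h'.split_symm_apply]
  have hf' : ∀ i < m, ∀ a, K (i + 2) (f a : W) = (f (h.restr i a) : W) := fun i hi a => by
    rw [hf i hi, h'.restr_coe hi]
  rw [h.split_symm_apply]
  simp only
  rw [key]
  match i, hi with
  | 0, _ =>
    have e1 := h.anti_apply (show 0 + 1 < m + 2 by omega) (b : V)
    have e2 := h'.anti_apply (show 0 + 1 < m + 2 by omega) (f b : W)
    rw [zero_add] at e1 e2
    rw [map_sub (J 0), map_sub (K 0), ← neg_eq_iff_eq_neg.2 e1, ← neg_eq_iff_eq_neg.2 e2,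
      apply_coe, apply_coe,
        apply_coe, apply_coe]
    have := key (Complex.I • a) (-(Complex.I • b))
    simpa using this
  | 1, _ =>
    have := key b a
    rw [map_sub (J 1), map_sub (K 1), h.sq_apply (by omega), h'.sq_apply (by omega)]
    have e : J 1 (a : V) - -(b : V) = ((b : V) - J 1 ((-a : (J 0).eigenspace Complex.I) : V)) := by
      simp [add_comm]
    rw [e, key]
    simp [add_comm]
  | 2, hi =>
    have e1 := h.anti_apply (show 1 + 1 < m + 2 by omega) (b : V)
    have e2 := h'.anti_apply (show 1 + 1 < m + 2 by omega) (f b : W)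
    have := key (h.restr 0 a) (-(h.restr 0 b))
    rw [map_sub (J 2), map_sub (K 2), e1, e2]
    rw [← hf' 0 (by omega)] at this
    simpa [h.restr_coe (show 0 < m by omega), ← hf' 0 (show 0 < m by omega)] using this
  | i + 3, hi =>
    have e1 := h.far_apply (show 1 + 2 ≤ i + 3 by omega) hi (b : V)
    have e2 := h'.far_apply (show 1 + 2 ≤ i + 3 by omega) hi (f b : W)
    have := key (h.restr (i + 1) a) (h.restr (i + 1) b)
    rw [map_sub (J (i + 3)), map_sub (K (i + 3)), ← e1, ← e2]
    simpa [h.restr_coe (show i + 1 < m by omega), ← hf' (i + 1) (show i + 1 < m by omega)]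
      using this

end Split

/-- Operators with the relations of an extraspecial group are determined up to isomorphism by the
dimension of the space. -/
theorem exists_linearEquiv (k : ℕ) : ∀ {V W : Type*} [AddCommGroup V] [Module ℂ V]
    [AddCommGroup W] [Module ℂ W] [FiniteDimensional ℂ V] [FiniteDimensional ℂ W]
    {J : ℕ → Module.End ℂ V} {K : ℕ → Module.End ℂ W}, ExtraspecialRelations (2 * k) J →
    ExtraspecialRelations (2 * k) K → Module.finrank ℂ V = Module.finrank ℂ W →
    ∃ e : V ≃ₗ[ℂ] W, ∀ i < 2 * k, ∀ v, e (J i v) = K i (e v) := by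
  induction k with
  | zero =>
    intro V W _ _ _ _ _ _ J K _ _ hd
    exact ⟨LinearEquiv.ofFinrankEq V W hd, fun i hi => by omega⟩
  | succ k ih =>
    intro V W _ _ _ _ _ _ J K h h' hd
    have h : ExtraspecialRelations (2 * k + 2) J := h
    have h' : ExtraspecialRelations (2 * k + 2) K := h'
    obtain ⟨f, hf⟩ := ih h.restr_extraspecialRelations h'.restr_extraspecialRelations
      (by have := h.finrank_eq; have := h'.finrank_eq; omega)
    exact h.exists_linearEquiv_of_restr h' f hf

/-- Each pair of operators that is split off halves the dimension. -/
theorem two_pow_dvd_finrank (k : ℕ) : ∀ {V : Type*} [AddCommGroup V] [Module ℂ V]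
    [FiniteDimensional ℂ V] {J : ℕ → Module.End ℂ V}, ExtraspecialRelations (2 * k) J →
    2 ^ k ∣ Module.finrank ℂ V := by
  induction k with
  | zero => simp
  | succ k ih =>
    intro V _ _ _ J h
    have h : ExtraspecialRelations (2 * k + 2) J := h
    rw [h.finrank_eq, pow_succ']
    exact mul_dvd_mul_left 2 (ih h.restr_extraspecialRelations)

/-- A space of the smallest possible dimension has no proper invariant subspaces. -/
theorem eq_bot_or_eq_top {k : ℕ} {V : Type*} [AddCommGroup V] [Module ℂ V]
    [FiniteDimensional ℂ V] {J : ℕ → Module.End ℂ V} (h : ExtraspecialRelations (2 * k) J)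
    (hd : Module.finrank ℂ V = 2 ^ k) (N : Submodule ℂ V)
    (hN : ∀ i < 2 * k, ∀ v ∈ N, J i v ∈ N) : N = ⊥ ∨ N = ⊤ := by
  -- The restrictions to `N` satisfy the same relations, so `2 ^ k` divides the dimension of `N`.
  let K : ℕ → Module.End ℂ N := fun i =>
    if hi : i < 2 * k then (J i).restrict (hN i hi) else 0
  have hK : ∀ i < 2 * k, ∀ v : N, (K i v : V) = J i v := fun i hi v => by simp [K, hi]
  have hrel : ExtraspecialRelations (2 * k) K :=
    { sq := fun i hi => by ext v; simp [hK i hi, h.sq_apply hi]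
      far := fun i j hij hj => by
        ext v
        simp [hK i (by omega), hK j hj, h.far_apply hij hj]
      anti := fun i hi => by
        ext v
        simp [hK i (by omega), hK (i + 1) hi, h.anti_apply hi] }
  rcases Nat.eq_zero_or_pos (Module.finrank ℂ N) with h0 | h0
  · exact Or.inl (Submodule.finrank_eq_zero.1 h0)
  · refine Or.inr (Submodule.eq_top_of_finrank_eq (le_antisymm N.finrank_le ?_))
    rw [hd]
    exact Nat.le_of_dvd h0 (two_pow_dvd_finrank k hrel)

end ExtraspecialRelations

/-! ## Operators given by generators -/

section Generators

variable {G : Type*} [Group G] {S : Set G}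

theorem intertwines_of_mem_closure {V W : Type*} [AddCommGroup V] [Module ℂ V] [AddCommGroup W]
    [Module ℂ W] (τ : Representation ℂ G V) (τ' : Representation ℂ G W) (f : V →ₗ[ℂ] W)
    (hf : ∀ s ∈ S, ∀ v, f (τ s v) = τ' s (f v)) {g : G} (hg : g ∈ Subgroup.closure S) (v : V) :
    f (τ g v) = τ' g (f v) := by
  induction hg using Subgroup.closure_induction generalizing v with
  | mem s hs => exact hf s hs v
  | one => simp
  | mul a b _ _ iha ihb => simp [iha, ihb]
  | inv a _ ih =>
    have := ih (τ a⁻¹ v)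
    rw [Representation.self_inv_apply] at this
    rw [this, Representation.inv_self_apply]

theorem commute_map_of_mem_closure {A : Type*} [Monoid A] (φ : G →* A) (z : A)
    (h : ∀ s ∈ S, Commute z (φ s)) {g : G} (hg : g ∈ Subgroup.closure S) : Commute z (φ g) := by
  induction hg using Subgroup.closure_induction with
  | mem s hs => exact h s hs
  | one => simp
  | mul a b _ _ iha ihb => rw [map_mul]; exact iha.mul_right ihb
  | inv a _ ih =>
    have : Commute z (φ.toHomUnits a : Aˣ) := ih
    simpa [← map_inv] using this.units_inv_right

end Generators

namespace BraidGroup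

theorem closure_range_σ (n : ℕ) :
    Subgroup.closure (Set.range (BraidGroup.σ : Fin (n - 1) → BraidGroup n)) = ⊤ :=
  PresentedGroup.closure_range_of _

theorem intertwines {n : ℕ} {V W : Type*} [AddCommGroup V] [Module ℂ V] [AddCommGroup W]
    [Module ℂ W] (τ : Representation ℂ (BraidGroup n) V) (τ' : Representation ℂ (BraidGroup n) W)
    (f : V →ₗ[ℂ] W) (hf : ∀ i v, f (τ (σ i) v) = τ' (σ i) (f v)) (b : BraidGroup n) (v : V) :
    f (τ b v) = τ' b (f v) := by
  refine intertwines_of_mem_closure (S := Set.range σ) τ τ' f ?_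
    (by rw [closure_range_σ]; trivial) v
  rintro _ ⟨i, rfl⟩ v
  exact hf i v

end BraidGroup

/-! ### Relations and normal forms in the nearly extraspecial groups -/

namespace NearlyExtraspecial

variable {m : ℕ}

theorem negOne_mul_negOne : negOne m * negOne m = 1 :=
  PresentedGroup.one_of_mem NearlyExtraspecialRel.neg_sq

theorem negOne_mul_x (i : Fin m) : negOne m * x i = x i * negOne m :=
  PresentedGroup.mk_eq_mk_of_mul_inv_mem (NearlyExtraspecialRel.neg_central i)

theorem x_mul_self (i : Fin m) : x i * x i = negOne m :=
  PresentedGroup.mk_eq_mk_of_mul_inv_mem (NearlyExtraspecialRel.sq i)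

theorem x_far {i j : Fin m} (h : (i : ℕ) + 2 ≤ j) : x i * x j = x j * x i :=
  PresentedGroup.mk_eq_mk_of_mul_inv_mem (NearlyExtraspecialRel.far i j h)

theorem x_anti {i j : Fin m} (h : (i : ℕ) + 1 = j) : x j * x i = negOne m * (x i * x j) :=
  PresentedGroup.mk_eq_mk_of_mul_inv_mem (NearlyExtraspecialRel.anti i j h)

theorem closure_generators :
    Subgroup.closure (insert (negOne m) (Set.range (x : Fin m → NearlyExtraspecial m))) = ⊤ := by
  rw [← PresentedGroup.closure_range_of]
  congr 1
  ext g
  constructor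
  · rintro (rfl | ⟨i, rfl⟩)
    exacts [⟨none, rfl⟩, ⟨some i, rfl⟩]
  · rintro ⟨_ | i, rfl⟩
    exacts [Or.inl rfl, Or.inr ⟨i, rfl⟩]

theorem mem_closure_generators (g : NearlyExtraspecial m) :
    g ∈ Subgroup.closure (insert (negOne m) (Set.range (x : Fin m → NearlyExtraspecial m))) := by
  rw [closure_generators]; trivial

theorem intertwines {V W : Type*} [AddCommGroup V] [Module ℂ V] [AddCommGroup W] [Module ℂ W]
    {τ : Representation ℂ (NearlyExtraspecial m) V} {τ' : Representation ℂ (NearlyExtraspecial m) W}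
    (hτ : IsOddRep τ) (hτ' : IsOddRep τ') (f : V →ₗ[ℂ] W)
    (hf : ∀ i v, f (τ (x i) v) = τ' (x i) (f v)) (g : NearlyExtraspecial m) (v : V) :
    f (τ g v) = τ' g (f v) := by
  refine intertwines_of_mem_closure τ τ' f ?_ (mem_closure_generators g) v
  rintro _ (rfl | ⟨i, rfl⟩) v
  · rw [IsOddRep] at hτ hτ'
    rw [hτ, hτ']
    simp
  · exact hf i v

/-- The operators by which the generators act. -/
noncomputable def op {V : Type*} [AddCommGroup V] [Module ℂ V]
    (τ : Representation ℂ (NearlyExtraspecial m) V) (i : ℕ) : Module.End ℂ V :=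
  if h : i < m then τ (x ⟨i, h⟩) else 0

theorem op_of_lt {V : Type*} [AddCommGroup V] [Module ℂ V]
    (τ : Representation ℂ (NearlyExtraspecial m) V) {i : ℕ} (h : i < m) :
    op τ i = τ (x ⟨i, h⟩) := dif_pos h

theorem op_extraspecialRelations {V : Type*} [AddCommGroup V] [Module ℂ V]
    {τ : Representation ℂ (NearlyExtraspecial m) V} (hτ : IsOddRep τ) :
    ExtraspecialRelations m (op τ) where
  sq i hi := by rw [op_of_lt τ hi, ← map_mul, x_mul_self, hτ]
  far i j hij hj := by
    rw [op_of_lt τ (show i < m by omega), op_of_lt τ hj, ← map_mul, ← map_mul, x_far hij]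
  anti i hi := by
    rw [op_of_lt τ (show i < m by omega), op_of_lt τ hi, ← map_mul, ← map_mul,
      x_anti (i := ⟨i, by omega⟩) (j := ⟨i + 1, hi⟩) rfl, map_mul, hτ, neg_one_mul]

/-- The subgroup generated by the central element and the first `p` generators. -/
def initial (m p : ℕ) : Subgroup (NearlyExtraspecial m) :=
  Subgroup.closure (insert (negOne m) (x '' {i : Fin m | (i : ℕ) < p}))

theorem negOne_mem_initial (p : ℕ) : negOne m ∈ initial m p :=
  Subgroup.subset_closure (Set.mem_insert _ _)

theorem x_mem_initial {p : ℕ} {i : Fin m} (hi : (i : ℕ) < p) : x i ∈ initial m p :=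
  Subgroup.subset_closure (Set.mem_insert_of_mem _ ⟨i, hi, rfl⟩)

theorem mem_initial_self (g : NearlyExtraspecial m) : g ∈ initial m m := by
  have : x '' {i : Fin m | (i : ℕ) < m} = Set.range x := by
    rw [← Set.image_univ]
    congr 1
    ext i
    simp
  rw [initial, this]
  exact mem_closure_generators g

theorem inv_x (i : Fin m) : (x i)⁻¹ = x i * negOne m := by
  rw [inv_eq_iff_mul_eq_one, ← mul_assoc, x_mul_self, negOne_mul_negOne]

theorem inv_negOne : (negOne m)⁻¹ = negOne m := by
  rw [inv_eq_iff_mul_eq_one, negOne_mul_negOne]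

theorem eq_one_or_eq_negOne_of_mem_initial_zero {g : NearlyExtraspecial m}
    (hg : g ∈ initial m 0) : g = 1 ∨ g = negOne m := by
  rw [initial] at hg
  induction hg using Subgroup.closure_induction with
  | mem y hy =>
    rcases hy with rfl | ⟨i, hi, rfl⟩
    · exact Or.inr rfl
    · simp at hi
  | one => exact Or.inl rfl
  | mul a b _ _ ha hb =>
    rcases ha with rfl | rfl <;> rcases hb with rfl | rfl <;> simp [negOne_mul_negOne]
  | inv a _ ha => rcases ha with rfl | rfl <;> simp [inv_negOne]

/-- Up to the central sign, `x p` commutes with the earlier generators and has trivial square, so it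
can be collected on the right with exponent zero or one. This normal form drives the induction in
`qubitRep_injective`. -/
theorem mem_or_eq_mul_of_mem_initial {p : Fin m} {g : NearlyExtraspecial m}
    (hg : g ∈ initial m (p + 1)) :
    g ∈ initial m p ∨ ∃ h ∈ initial m p, g = h * x p := by
  have step : ∀ g : NearlyExtraspecial m, (g ∈ initial m p ∨ ∃ h ∈ initial m p, g = h * x p) →
      ∀ y ∈ insert (negOne m) (x '' {i : Fin m | (i : ℕ) < p + 1}),
      g * y ∈ initial m p ∨ ∃ h ∈ initial m p, g * y = h * x p := by
    rintro g hg _ (rfl | ⟨i, hi, rfl⟩)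
    · rcases hg with hg | ⟨h, hh, rfl⟩
      · exact Or.inl (mul_mem hg (negOne_mem_initial _))
      · exact Or.inr ⟨h * negOne m, mul_mem hh (negOne_mem_initial _), by
          rw [mul_assoc, mul_assoc, negOne_mul_x]⟩
    · rw [Set.mem_ofPred_eq] at hi
      rcases (Nat.lt_succ_iff_lt_or_eq.1 hi) with hi | hi
      · rcases hg with hg | ⟨h, hh, rfl⟩
        · exact Or.inl (mul_mem hg (x_mem_initial hi))
        · by_cases h2 : (i : ℕ) + 2 ≤ p
          · exact Or.inr ⟨h * x i, mul_mem hh (x_mem_initial hi), by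
              rw [mul_assoc, mul_assoc, x_far h2]⟩
          · refine Or.inr ⟨h * (negOne m * x i), mul_mem hh (mul_mem (negOne_mem_initial _)
              (x_mem_initial hi)), ?_⟩
            rw [mul_assoc, mul_assoc, mul_assoc, x_anti (show (i : ℕ) + 1 = p by omega)]
      · obtain rfl := Fin.ext hi
        rcases hg with hg | ⟨h, hh, rfl⟩
        · exact Or.inr ⟨g, hg, rfl⟩
        · exact Or.inl (by
            rw [mul_assoc, x_mul_self]; exact mul_mem hh (negOne_mem_initial _))
  induction hg using Subgroup.closure_induction_right with
  | one => exact Or.inl (one_mem _)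
  | mul_right g _ y hy ih => exact step g ih y hy
  | mul_inv_cancel g _ y hy ih =>
    have h1 := step g ih y hy
    rcases hy with rfl | ⟨i, hi, rfl⟩
    · rwa [inv_negOne]
    · rw [inv_x, ← mul_assoc]
      exact step _ h1 _ (Set.mem_insert _ _)

end NearlyExtraspecial

/-! ## Tensor powers of `ℂ²` -/

/-- The standard basis of the tensor power. -/
noncomputable def Qubits.basis (n : ℕ) : Module.Basis (Fin n → Fin 2) ℂ (Qubits n) :=
  Basis.piTensorProduct fun _ : Fin n => Pi.basisFun ℂ (Fin 2)

noncomputable instance (n : ℕ) : FiniteDimensional ℂ (Qubits n) :=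
  (Qubits.basis n).finiteDimensional_of_finite

theorem finrank_qubits (n : ℕ) : Module.finrank ℂ (Qubits n) = 2 ^ n := by
  simp [Module.finrank_eq_card_basis (Qubits.basis n)]

instance (n : ℕ) : Nontrivial (Qubits n) :=
  Module.nontrivial_of_finrank_pos (R := ℂ) (by rw [finrank_qubits]; positivity)

theorem eq_zero_of_eq_neg {V : Type*} [AddCommGroup V] [Module ℂ V] {v : V} (h : v = -v) :
    v = 0 := by
  have h2 : (2 : ℂ) • v = 0 := by
    rw [two_smul]
    nth_rewrite 2 [h]
    exact add_neg_cancel v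
  exact (smul_eq_zero.1 h2).resolve_left two_ne_zero

theorem matσz_mul_matσx : matσz * matσx = -(matσx * matσz) := by
  ext i j; fin_cases i <;> fin_cases j <;> simp [matσx, matσz]

/-! ## The pure braid group acts through the nearly extraspecial group -/

/-- The representation of the nearly extraspecial group on `(ℂ²)^{⊗ n}` through which the pure
braid group acts. -/
noncomputable def qubitRep (n : ℕ) : Representation ℂ (NearlyExtraspecial (n - 1)) (Qubits n) :=
  extraspecialRep (yangBaxter_extraspecialRelations n)

theorem qubitRep_x {n : ℕ} (i : Fin (n - 1)) :
    qubitRep n (NearlyExtraspecial.x i) = site i matS * site (i + 1) matσx :=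
  extraspecialRep_x _ i

theorem qubitRep_odd (n : ℕ) : IsOddRep (qubitRep n) := extraspecialRep_negOne _

/-- Take `σ_z` on the factor `p + 1`. It commutes with the first `p` generators, which act on the
factors up to `p`, and anticommutes with `x p`, which acts there by `σ_x`. If `h * x p` with `h ∈
initial (n - 1) p` acted as the identity, then `σ_z` would equal its own negative. Hence a group
element acting trivially lies in smaller and smaller initial subgroups, finally in `{1, -1}`, and
`-1` acts nontrivially. -/
theorem qubitRep_injective (n : ℕ) : Function.Injective (qubitRep n) := by
  have main : ∀ p ≤ n - 1, ∀ g ∈ NearlyExtraspecial.initial (n - 1) p, qubitRep n g = 1 →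
      g = 1 := by
    intro p
    induction p with
    | zero =>
      intro _ g hg h1
      rcases NearlyExtraspecial.eq_one_or_eq_negOne_of_mem_initial_zero hg with rfl | rfl
      · rfl
      · rw [qubitRep_odd n] at h1
        exact absurd (eq_zero_of_eq_neg h1.symm) one_ne_zero
    | succ p ih =>
      intro hp g hg h1
      have hp' : p < n - 1 := hp
      rcases NearlyExtraspecial.mem_or_eq_mul_of_mem_initial (p := ⟨p, hp'⟩) hg with h | ⟨h, hh, rfl⟩
      · exact ih (by omega) g h h1
      · exfalso
        have hc : Commute (site (p + 1) matσz : Module.End ℂ (Qubits n)) (qubitRep n h) := by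
          refine commute_map_of_mem_closure (qubitRep n) _ ?_ hh
          rintro _ (rfl | ⟨i, hi, rfl⟩)
          · rw [qubitRep_odd n]
            exact (Commute.one_right _).neg_right
          · rw [Set.mem_ofPred_eq] at hi
            simp only at hi
            rw [qubitRep_x]
            exact Commute.mul_right (site_comm (by omega) _ _) (site_comm (by omega) _ _)
        have ha : (site (p + 1) matσz : Module.End ℂ (Qubits n)) *
            qubitRep n (NearlyExtraspecial.x ⟨p, hp'⟩) =
            -(qubitRep n (NearlyExtraspecial.x ⟨p, hp'⟩) * site (p + 1) matσz) := by
          rw [qubitRep_x]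
          simp only
          rw [← mul_assoc, site_comm (show p + 1 ≠ p by omega), mul_assoc, site_mul,
            matσz_mul_matσx, site_neg (by omega), ← site_mul, mul_neg, mul_assoc]
        have hz : (site (p + 1) matσz : Module.End ℂ (Qubits n)) = -site (p + 1) matσz := by
          calc (site (p + 1) matσz : Module.End ℂ (Qubits n))
              = site (p + 1) matσz * qubitRep n (h * NearlyExtraspecial.x ⟨p, hp'⟩) := by
                rw [h1, mul_one]
            _ = -(qubitRep n (h * NearlyExtraspecial.x ⟨p, hp'⟩) * site (p + 1) matσz) := by
                rw [map_mul, ← mul_assoc, hc.eq, mul_assoc, ha, mul_neg, mul_assoc]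
            _ = -site (p + 1) matσz := by rw [h1, one_mul]
        have h0 : (site (p + 1) matσz : Module.End ℂ (Qubits n)) = 0 := eq_zero_of_eq_neg hz
        have := site_matσz_sq n (p + 1)
        rw [h0, mul_zero] at this
        exact zero_ne_one this
  exact (injective_iff_map_eq_one _).2 fun g hg =>
    main (n - 1) le_rfl g (NearlyExtraspecial.mem_initial_self g) hg

/-- If `J i` and `J l` anticommute, then `J i * J l * J i = J l`, and both sides of the second
alternative equal `J l + J i * J l`. Up to a scalar `1 + J i` is a braid generator, so conjugation
by it preserves the group generated by the `J l`. -/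
theorem ExtraspecialRelations.conj {A : Type*} [Ring A] [Algebra ℂ A] {m : ℕ} {J : ℕ → A}
    (h : ExtraspecialRelations m J) {i l : ℕ} (hi : i < m) (hl : l < m) :
    (1 + J i) * J l = J l * (1 + J i) ∨ (1 + J i) * J l = J i * J l * (1 + J i) := by
  by_cases hanti : l = i + 1 ∨ i = l + 1
  · right
    have ha : J i * J l = -(J l * J i) := by
      rcases hanti with rfl | rfl
      · rw [h.anti i hl, neg_neg]
      · exact h.anti l hi
    have : J i * J l * J i = J l := by
      rw [ha, neg_mul, mul_assoc, h.sq i hi, mul_neg_one, neg_neg]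
    rw [add_mul, mul_add, this, one_mul, mul_one, add_comm]
  · left
    have hc : J i * J l = J l * J i := by
      rcases lt_trichotomy i l with h1 | rfl | h1
      · exact h.far i l (by omega) hl
      · rfl
      · exact (h.far l i (by omega) hi).symm
    rw [add_mul, mul_add, hc, one_mul, mul_one]

theorem yangBaxterRep_σ {n : ℕ} (i : Fin (n - 1)) :
    yangBaxterRep n (BraidGroup.σ i) =
      (((√2 : ℝ) : ℂ)⁻¹) • (1 + qubitRep n (NearlyExtraspecial.x i)) := by
  rw [yangBaxterRep, braidRep_σ, sitePair_matR (by omega), qubitRep_x]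

/-- With `J ^ 2 = -1` one has `(1 + J) ^ 2 = 2 J`, and the factor `1 / √2` absorbs the `2`. -/
theorem yangBaxterRep_σ_sq {n : ℕ} (i : Fin (n - 1)) :
    yangBaxterRep n (BraidGroup.σ i) * yangBaxterRep n (BraidGroup.σ i) =
      qubitRep n (NearlyExtraspecial.x i) := by
  have hs : qubitRep n (NearlyExtraspecial.x i) * qubitRep n (NearlyExtraspecial.x i) = -1 := by
    rw [← map_mul, NearlyExtraspecial.x_mul_self, qubitRep_odd n]
  rw [yangBaxterRep_σ, smul_mul_smul_comm, sqrtTwo_inv_sq, add_mul, mul_add, mul_add, hs]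
  simp only [one_mul, mul_one]
  module

/-- Stability of the image of `qubitRep` under conjugation by the braid generators, written without
inverses because the operators live in an endomorphism ring. For the generators it is
`ExtraspecialRelations.conj`. -/
theorem yangBaxterRep_σ_mul {n : ℕ} (i : Fin (n - 1)) (g : NearlyExtraspecial (n - 1)) :
    ∃ g', yangBaxterRep n (BraidGroup.σ i) * qubitRep n g =
      qubitRep n g' * yangBaxterRep n (BraidGroup.σ i) := by
  have hg := NearlyExtraspecial.mem_closure_generators g
  induction hg using Subgroup.closure_induction with
  | mem y hy =>
    rcases hy with rfl | ⟨l, rfl⟩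
    · exact ⟨NearlyExtraspecial.negOne _, by rw [qubitRep_odd n]; simp⟩
    · rw [yangBaxterRep_σ]
      have := (yangBaxter_extraspecialRelations n).conj i.2 l.2
      rw [← qubitRep_x, ← qubitRep_x] at this
      rcases this with h | h
      · exact ⟨NearlyExtraspecial.x l, by rw [smul_mul_assoc, h, mul_smul_comm]⟩
      · exact ⟨NearlyExtraspecial.x i * NearlyExtraspecial.x l, by
          rw [smul_mul_assoc, h, mul_smul_comm, map_mul]⟩
  | one => exact ⟨1, by simp⟩
  | mul a b _ _ ha hb =>
    obtain ⟨a', ha⟩ := ha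
    obtain ⟨b', hb⟩ := hb
    exact ⟨a' * b', by rw [map_mul, ← mul_assoc, ha, mul_assoc, hb, map_mul, mul_assoc]⟩
  | inv a _ ha =>
    obtain ⟨a', ha⟩ := ha
    refine ⟨a'⁻¹, ?_⟩
    have h1 : qubitRep n a * qubitRep n a⁻¹ = 1 := by rw [← map_mul, mul_inv_cancel, map_one]
    have h2 : qubitRep n a'⁻¹ * qubitRep n a' = 1 := by rw [← map_mul, inv_mul_cancel, map_one]
    calc _ = (qubitRep n a'⁻¹ * qubitRep n a') * yangBaxterRep n (BraidGroup.σ i) *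
          qubitRep n a⁻¹ := by rw [h2, one_mul]
      _ = qubitRep n a'⁻¹ * (yangBaxterRep n (BraidGroup.σ i) * qubitRep n a) *
          qubitRep n a⁻¹ := by rw [ha]; simp only [mul_assoc]
      _ = _ := by simp only [mul_assoc]; rw [h1, mul_one]

/-- If `t ^ 2` belongs to a subgroup which is stable under conjugation by `t`, then `t` normalizes
this subgroup. -/
theorem mem_normalizer_of_sq_mem {G : Type*} [Group G] {N : Subgroup G} {t : G} (ht : t * t ∈ N)
    (h : ∀ a ∈ N, t * a * t⁻¹ ∈ N) : t ∈ Subgroup.normalizer (N : Set G) := by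
  rw [Subgroup.mem_normalizer_iff]
  refine fun a => ⟨h a, fun ha => ?_⟩
  -- A second conjugation by `t` gives `t ^ 2 * a * t ^ (-2) ∈ N`, from which `t ^ 2 ∈ N` recovers
  -- `a`.
  have := mul_mem (mul_mem (inv_mem ht) (h _ ha)) ht
  convert this using 1
  group

/-- Inside the unit group of the endomorphism ring, the image of the nearly extraspecial group is
normalized by the braid generators and contains their squares, so `map_mem_of_mem_pureBraidGroup`
applies. -/
theorem exists_yangBaxterRep_eq {n : ℕ} {p : BraidGroup n} (hp : p ∈ PureBraidGroup n) :
    ∃ g, qubitRep n g = yangBaxterRep n p := by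
  have h := map_mem_of_mem_pureBraidGroup (yangBaxterRep n).toHomUnits
    (qubitRep n).toHomUnits.range (fun i => ?_) (fun i => ?_) hp
  · obtain ⟨g, hg⟩ := h
    have h1 := congrArg Units.val hg
    rw [MonoidHom.coe_toHomUnits, MonoidHom.coe_toHomUnits] at h1
    exact ⟨g, h1⟩
  · refine mem_normalizer_of_sq_mem ⟨NearlyExtraspecial.x i, ?_⟩ ?_
    · exact Units.ext (yangBaxterRep_σ_sq i).symm
    · rintro _ ⟨g, rfl⟩
      obtain ⟨g', hg'⟩ := yangBaxterRep_σ_mul i g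
      exact ⟨g', by rw [eq_mul_inv_iff_mul_eq]; exact Units.ext hg'.symm⟩
  · exact ⟨NearlyExtraspecial.x i, Units.ext (yangBaxterRep_σ_sq i).symm⟩

/-- The homomorphism from the pure braid group to the nearly extraspecial group through which the
pure braid group acts on `(ℂ²)^{⊗ n}`. -/
noncomputable def pureToExtraspecial (n : ℕ) :
    PureBraidGroup n →* NearlyExtraspecial (n - 1) where
  toFun p := (exists_yangBaxterRep_eq p.2).choose
  -- The chosen preimages are unique because `qubitRep` is faithful, so the choice is
  -- multiplicative.
  map_one' := qubitRep_injective n (by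
    rw [(exists_yangBaxterRep_eq (1 : PureBraidGroup n).2).choose_spec, map_one]
    exact map_one _)
  map_mul' p q := qubitRep_injective n (by
    rw [(exists_yangBaxterRep_eq (p * q).2).choose_spec, map_mul,
      (exists_yangBaxterRep_eq p.2).choose_spec, (exists_yangBaxterRep_eq q.2).choose_spec]
    exact map_mul _ _ _)

theorem qubitRep_pureToExtraspecial {n : ℕ} (p : PureBraidGroup n) :
    qubitRep n (pureToExtraspecial n p) = restrictPure (yangBaxterRep n) p :=
  (exists_yangBaxterRep_eq p.2).choose_spec

theorem pureToExtraspecial_σsq {n : ℕ} (i : Fin (n - 1)) :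
    pureToExtraspecial n (PureBraidGroup.σsq i) = NearlyExtraspecial.x i :=
  qubitRep_injective n (by
    rw [qubitRep_pureToExtraspecial, ← yangBaxterRep_σ_sq, ← map_mul, ← pow_two]
    rfl)

theorem pureToExtraspecial_eq_one_iff {n : ℕ} (p : PureBraidGroup n) :
    pureToExtraspecial n p = 1 ↔ restrictPure (yangBaxterRep n) p = 1 := by
  rw [← qubitRep_pureToExtraspecial, ← (qubitRep_injective n).eq_iff, map_one]

theorem pureToExtraspecial_surjective {n : ℕ} (hn : 2 ≤ n) :
    Function.Surjective (pureToExtraspecial n) := by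
  have hx : ∀ i, NearlyExtraspecial.x i ∈ (pureToExtraspecial n).range := fun i =>
    ⟨_, pureToExtraspecial_σsq i⟩
  rw [← MonoidHom.range_eq_top, eq_top_iff, ← NearlyExtraspecial.closure_generators,
    Subgroup.closure_le]
  rintro _ (rfl | ⟨i, rfl⟩)
  · rw [← NearlyExtraspecial.x_mul_self ⟨0, by omega⟩]
    exact mul_mem (hx _) (hx _)
  · exact hx i

/-! ## Irreducibility and Schur's lemma -/

theorem Representation.isIrreducible_of_forall_submodule {G V : Type*} [Group G] [AddCommGroup V]
    [Module ℂ V] [Nontrivial V] {ρ : Representation ℂ G V}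
    (h : ∀ N : Submodule ℂ V, (∀ g, ∀ v ∈ N, ρ g v ∈ N) → N = ⊥ ∨ N = ⊤) :
    ρ.IsIrreducible where
  exists_pair_ne := ⟨⊥, ⊤, fun h0 => bot_ne_top (α := Submodule ℂ V)
    (congrArg Subrepresentation.toSubmodule h0)⟩
  eq_bot_or_eq_top N := (h N.toSubmodule fun g _ hv => N.apply_mem_toSubmodule g hv).imp
    (fun h => Subrepresentation.toSubmodule_injective h)
    (fun h => Subrepresentation.toSubmodule_injective h)

theorem Representation.exists_eq_smul_one_of_commute {G V : Type*} [Group G] [AddCommGroup V]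
    [Module ℂ V] [FiniteDimensional ℂ V] {ρ : Representation ℂ G V} (hρ : ρ.IsIrreducible)
    {f : Module.End ℂ V} (hf : ∀ g, Commute f (ρ g)) : ∃ c : ℂ, f = c • 1 := by
  obtain ⟨c, hc⟩ := (Representation.IsIrreducible.algebraMap_intertwiningMap_bijective_of_isAlgClosed
    (ρ := ρ)).2 ⟨f, fun g => (hf g).eq⟩
  exact ⟨c, (congrArg Representation.IntertwiningMap.toLinearMap hc).symm⟩

theorem Representation.IsIrreducible.nontrivial {G V : Type*} [Group G] [AddCommGroup V]
    [Module ℂ V] {ρ : Representation ℂ G V} (hρ : ρ.IsIrreducible) : Nontrivial V := by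
  by_contra h
  rw [not_nontrivial_iff_subsingleton] at h
  obtain ⟨a, b, hab⟩ := hρ.exists_pair_ne
  exact hab (Subrepresentation.toSubmodule_injective (Subsingleton.elim _ _))

/-- By Schur's lemma the central element of order two acts as `1` or `-1`. If it acts as `1`, all
generators commute, hence act as scalars, every line is invariant and the dimension is one. -/
theorem NearlyExtraspecial.isOddRep_of_finrank_ne_one {m : ℕ} {V : Type*} [AddCommGroup V]
    [Module ℂ V] [FiniteDimensional ℂ V] {τ : Representation ℂ (NearlyExtraspecial m) V}
    (hτ : τ.IsIrreducible) (hd : Module.finrank ℂ V ≠ 1) : IsOddRep τ := by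
  have hcomm : ∀ A : Module.End ℂ V, Commute A (τ (negOne m)) → (∀ i, Commute A (τ (x i))) →
      ∃ c : ℂ, A = c • 1 := by
    intro A h1 h2
    refine Representation.exists_eq_smul_one_of_commute hτ fun g => ?_
    refine commute_map_of_mem_closure τ A ?_ (mem_closure_generators g)
    rintro _ (rfl | ⟨i, rfl⟩)
    exacts [h1, h2 i]
  obtain ⟨c, hc⟩ := hcomm (τ (negOne m)) (Commute.refl _) fun i => by
    rw [Commute, SemiconjBy, ← map_mul, negOne_mul_x, map_mul]
  have hnt := hτ.nontrivial
  have hcc : c * c = 1 := by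
    have h1 : τ (negOne m) * τ (negOne m) = 1 := by
      rw [← map_mul, negOne_mul_negOne, map_one]
    rw [hc, smul_mul_smul_comm, one_mul] at h1
    have h2 : (c * c - 1) • (1 : Module.End ℂ V) = 0 := by rw [sub_smul, h1, one_smul, sub_self]
    exact sub_eq_zero.1 ((smul_eq_zero.1 h2).resolve_right one_ne_zero)
  rcases mul_self_eq_one_iff.1 hcc with rfl | rfl
  · exfalso
    rw [one_smul] at hc
    have hx : ∀ i, ∃ c : ℂ, τ (x i) = c • 1 := by
      intro i
      refine hcomm _ (by rw [hc]; exact Commute.one_right _) fun j => ?_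
      rw [Commute, SemiconjBy, ← map_mul, ← map_mul]
      rcases lt_trichotomy (i : ℕ) j with h | h | h
      · by_cases h2 : (i : ℕ) + 2 ≤ j
        · rw [x_far h2]
        · rw [x_anti (show (i : ℕ) + 1 = j by omega), map_mul τ (negOne m), hc, one_mul]
      · rw [Fin.ext h]
      · by_cases h2 : (j : ℕ) + 2 ≤ i
        · rw [x_far h2]
        · rw [x_anti (show (j : ℕ) + 1 = i by omega), map_mul τ (negOne m), hc, one_mul]
    obtain ⟨v, hv⟩ := exists_ne (0 : V)
    have hs : ∀ g, ∃ c : ℂ, τ g = c • 1 := by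
      intro g
      refine Representation.exists_eq_smul_one_of_commute hτ fun g' => ?_
      refine commute_map_of_mem_closure τ _ ?_ (mem_closure_generators g')
      rintro _ (rfl | ⟨i, rfl⟩)
      · rw [hc]; exact Commute.one_right _
      · obtain ⟨c, h⟩ := hx i
        rw [h]; exact (Commute.one_right _).smul_right c
    let N : Subrepresentation τ := ⟨Submodule.span ℂ {v}, fun g w hw => by
      obtain ⟨c, h⟩ := hs g
      rw [h]
      exact Submodule.smul_mem _ c hw⟩
    have hN : Submodule.span ℂ {v} = ⊤ := by
      rcases hτ.eq_bot_or_eq_top N with h | h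
      · exact absurd (Submodule.span_singleton_eq_bot.1
          (congrArg Subrepresentation.toSubmodule h)) hv
      · exact congrArg Subrepresentation.toSubmodule h
    exact hd (by rw [← finrank_top, ← hN, finrank_span_singleton hv])
  · rw [IsOddRep, hc, neg_one_smul]

theorem NearlyExtraspecial.nonempty_equiv_of_ne_zero {m : ℕ} {V W : Type*} [AddCommGroup V]
    [Module ℂ V] [AddCommGroup W] [Module ℂ W] {τ : Representation ℂ (NearlyExtraspecial m) V}
    {τ' : Representation ℂ (NearlyExtraspecial m) W} (hτ : τ.IsIrreducible)
    (hτ' : τ'.IsIrreducible) (ho : IsOddRep τ) (ho' : IsOddRep τ') {f : V →ₗ[ℂ] W} (hf0 : f ≠ 0)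
    (hf : ∀ i v, f (τ (x i) v) = τ' (x i) (f v)) : Nonempty (Representation.Equiv τ τ') := by
  let F : Representation.IntertwiningMap τ τ' :=
    ⟨f, fun g => LinearMap.ext fun v => NearlyExtraspecial.intertwines ho ho' f hf g v⟩
  have hF : F ≠ 0 := fun h => hf0 (congrArg Representation.IntertwiningMap.toLinearMap h)
  exact ⟨F.ofBijective
    ((Representation.IsIrreducible.bijective_or_eq_zero F).resolve_right hF)⟩

/-! ### Powers, direct sums and doubling of families of operators -/

namespace ExtraspecialRelations

theorem compLeft {V : Type*} [AddCommGroup V] [Module ℂ V] {m : ℕ} {J : ℕ → Module.End ℂ V}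
    (h : ExtraspecialRelations m J) (ι : Type*) :
    ExtraspecialRelations (A := Module.End ℂ (ι → V)) m fun i => (J i).compLeft ι where
  sq i hi := by ext1 f; funext a; exact h.sq_apply hi (f a)
  far i j hij hj := by ext1 f; funext a; exact h.far_apply hij hj (f a)
  anti i hi := by ext1 f; funext a; exact h.anti_apply hi (f a)

theorem prodMap {V W : Type*} [AddCommGroup V] [Module ℂ V] [AddCommGroup W] [Module ℂ W] {m : ℕ}
    {J : ℕ → Module.End ℂ V} {K : ℕ → Module.End ℂ W} (h : ExtraspecialRelations m J)
    (h' : ExtraspecialRelations m K) :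
    ExtraspecialRelations (A := Module.End ℂ (V × W)) m fun i => (J i).prodMap (K i) where
  sq _ hi := LinearMap.ext fun v => Prod.ext (h.sq_apply hi v.1) (h'.sq_apply hi v.2)
  far _ _ hij hj := LinearMap.ext fun v =>
    Prod.ext (h.far_apply hij hj v.1) (h'.far_apply hij hj v.2)
  anti _ hi := LinearMap.ext fun v => Prod.ext (h.anti_apply hi v.1) (h'.anti_apply hi v.2)

/-- Provides the companion family which `double` requires. -/
theorem negLast {A : Type*} [Ring A] {m : ℕ} {J : ℕ → A} (h : ExtraspecialRelations (m + 1) J) :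
    ExtraspecialRelations (m + 1) fun i => if i < m then J i else -J i where
  sq i hi := by split_ifs <;> simp [h.sq i hi]
  far i j hij hj := by
    rw [if_pos (show i < m by omega)]
    split_ifs <;> simp [h.far i j hij hj]
  anti i hi := by
    rw [if_pos (show i < m by omega)]
    split_ifs <;> simp [h.anti i hi]

/-- The operator `(u, v) ↦ (-v, u)`. -/
def quarterTurn (V : Type*) [AddCommGroup V] [Module ℂ V] : Module.End ℂ (V × V) :=
  (-LinearMap.snd ℂ V V).prod (LinearMap.fst ℂ V V)

/-- Two families of operators which only differ in the sign of the last member yield a family with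
one more member on the direct sum. -/
theorem double {V : Type*} [AddCommGroup V] [Module ℂ V] {m : ℕ} {J K : ℕ → Module.End ℂ V}
    (h : ExtraspecialRelations (m + 1) J) (h' : ExtraspecialRelations (m + 1) K)
    (hlt : ∀ i < m, K i = J i) (hm : K m = -J m) :
    ExtraspecialRelations (A := Module.End ℂ (V × V)) (m + 2) fun i =>
      if i < m + 1 then (J i).prodMap (K i) else quarterTurn V := by
  refine (h.prodMap h').snoc ?_ (fun i hi => ?_) ?_
  · ext v <;> simp [quarterTurn]
  · rw [hlt i hi]
    ext v <;> simp [quarterTurn]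
  · rw [hm]
    ext v <;> simp [quarterTurn]

/-- Any two nonzero families of operators admit a nonzero map which intertwines them. -/
theorem exists_ne_zero {k : ℕ} {V W : Type*} [AddCommGroup V] [Module ℂ V] [AddCommGroup W]
    [Module ℂ W] [FiniteDimensional ℂ V] [FiniteDimensional ℂ W] [Nontrivial V] [Nontrivial W]
    {J : ℕ → Module.End ℂ V} {K : ℕ → Module.End ℂ W} (h : ExtraspecialRelations (2 * k) J)
    (h' : ExtraspecialRelations (2 * k) K) :
    ∃ f : V →ₗ[ℂ] W, f ≠ 0 ∧ ∀ i < 2 * k, ∀ v, f (J i v) = K i (f v) := by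
  -- The sum of `dim W` copies of `V` and the sum of `dim V` copies of `W` have the same dimension,
  -- hence are isomorphic as spaces with operators. Any nonzero block of the isomorphism is the
  -- required map.
  obtain ⟨e, he⟩ := exists_linearEquiv k (h.compLeft (Fin (Module.finrank ℂ W)))
    (h'.compLeft (Fin (Module.finrank ℂ V))) (by
      rw [Module.finrank_pi_fintype, Module.finrank_pi_fintype]
      simp [mul_comm])
  obtain ⟨v, hv⟩ := exists_ne (0 : V)
  let a : Fin (Module.finrank ℂ W) := ⟨0, Module.finrank_pos⟩
  have h0 : e (Pi.single a v) ≠ 0 := by simpa using hv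
  obtain ⟨b, hb⟩ := Function.ne_iff.1 h0
  refine ⟨LinearMap.proj b ∘ₗ e.toLinearMap ∘ₗ LinearMap.single ℂ (fun _ => V) a,
    fun h => hb (congrArg (fun f : V →ₗ[ℂ] W => f v) h), fun i hi w => ?_⟩
  have h1 : (Pi.single a (J i w) : Fin (Module.finrank ℂ W) → V) =
      (J i).compLeft _ (Pi.single a w) := by
    funext c
    simp only [LinearMap.compLeft_apply, Function.comp_apply]
    exact Pi.apply_single (fun _ => J i) (fun _ => map_zero _) a w c ▸ rfl
  simp only [LinearMap.comp_apply, LinearMap.coe_single, LinearEquiv.coe_coe, LinearMap.proj_apply]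
  rw [h1, he i hi]
  rfl

end ExtraspecialRelations

/-! ## The odd irreducible representations -/

theorem rho_x {k : ℕ} (i : Fin (2 * k)) : rho k (NearlyExtraspecial.x i) = rhoOp k i :=
  extraspecialRep_x _ i

theorem lambda_x {k : ℕ} (ε : ℤˣ) (i : Fin (2 * k + 1)) :
    lambda k ε (NearlyExtraspecial.x i) = lambdaOp k ε i :=
  extraspecialRep_x _ i

theorem rho_odd (k : ℕ) : IsOddRep (rho k) := extraspecialRep_negOne _

theorem lambda_odd (k : ℕ) (ε : ℤˣ) : IsOddRep (lambda k ε) := extraspecialRep_negOne _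

theorem lambdaOp_of_lt {k i : ℕ} (ε : ℤˣ) (hi : i < 2 * k) : lambdaOp k ε i = rhoOp k i :=
  if_pos hi

theorem lambdaOp_neg_one_last (k : ℕ) : lambdaOp k (-1) (2 * k) = -lambdaOp k 1 (2 * k) := by
  simp [lambdaOp_last]

theorem rhoHat_σ {k : ℕ} (i : Fin (2 * k)) : rhoHat k (BraidGroup.σ (n := 2 * k + 1) i) =
    (((√2 : ℝ) : ℂ)⁻¹) • (1 + rho k (NearlyExtraspecial.x i)) := by
  rw [rho_x, ← rhoHatOp_eq i.2]
  exact braidRep_σ (n := 2 * k + 1) _ i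

theorem lambdaHat_σ {k : ℕ} (ε : ℤˣ) (i : Fin (2 * k + 1)) :
    lambdaHat k ε (BraidGroup.σ (n := 2 * k + 2) i) =
      (((√2 : ℝ) : ℂ)⁻¹) • (1 + lambda k ε (NearlyExtraspecial.x i)) := by
  rw [lambda_x, ← lambdaHatOp_eq]
  exact braidRep_σ (n := 2 * k + 2) _ i

theorem rhoOp_submodule {k : ℕ} (N : Submodule ℂ (Qubits k))
    (hN : ∀ i < 2 * k, ∀ v ∈ N, rhoOp k i v ∈ N) : N = ⊥ ∨ N = ⊤ :=
  (rhoOp_extraspecialRelations k).eq_bot_or_eq_top (finrank_qubits k) N hN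

theorem sqrtTwo_inv_ne_zero : ((√2 : ℝ) : ℂ)⁻¹ ≠ 0 := by simp

/-- Turns invariance under a braid generator into invariance under the corresponding extraspecial
generator, so irreducibility passes to the braid group. -/
theorem mem_of_smul_one_add_mem {V : Type*} [AddCommGroup V] [Module ℂ V] {N : Submodule ℂ V}
    {c : ℂ} (hc : c ≠ 0) {A : Module.End ℂ V} {v : V} (hv : v ∈ N)
    (h : (c • (1 + A)) v ∈ N) : A v ∈ N := by
  rw [LinearMap.smul_apply, N.smul_mem_iff hc, LinearMap.add_apply, Module.End.one_apply] at h
  exact (N.add_mem_iff_right hv).1 h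

theorem rho_isIrreducible (k : ℕ) : (rho k).IsIrreducible :=
  Representation.isIrreducible_of_forall_submodule fun N hN => rhoOp_submodule N fun i hi v hv => by
    have := hN (NearlyExtraspecial.x ⟨i, hi⟩) v hv
    rwa [rho_x] at this

/-- The first `2 k` generators, which act as in `rho k`, already leave no proper subspace invariant.
-/
theorem lambda_isIrreducible (k : ℕ) (ε : ℤˣ) : (lambda k ε).IsIrreducible :=
  Representation.isIrreducible_of_forall_submodule fun N hN => rhoOp_submodule N fun i hi v hv => by
    have := hN (NearlyExtraspecial.x ⟨i, by omega⟩) v hv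
    rwa [lambda_x, lambdaOp_of_lt ε hi] at this

theorem rhoHat_isIrreducible (k : ℕ) : (rhoHat k).IsIrreducible :=
  Representation.isIrreducible_of_forall_submodule fun N hN => rhoOp_submodule N fun i hi v hv => by
    have := hN (BraidGroup.σ (n := 2 * k + 1) (⟨i, hi⟩ : Fin (2 * k))) v hv
    rw [rhoHat_σ, rho_x] at this
    exact mem_of_smul_one_add_mem sqrtTwo_inv_ne_zero hv this

theorem lambdaHat_isIrreducible (k : ℕ) (ε : ℤˣ) : (lambdaHat k ε).IsIrreducible :=
  Representation.isIrreducible_of_forall_submodule fun N hN => rhoOp_submodule N fun i hi v hv => by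
    have := hN (BraidGroup.σ (n := 2 * k + 2) (⟨i, by omega⟩ : Fin (2 * k + 1))) v hv
    rw [lambdaHat_σ, lambda_x, lambdaOp_of_lt ε hi] at this
    exact mem_of_smul_one_add_mem sqrtTwo_inv_ne_zero hv this

/-- The first `2 k` operators of the two families agree and act irreducibly, so `e` is a scalar. A
nonzero scalar cannot intertwine the last operators, which are invertible and opposite to each
other. This excludes equivalences for the nearly extraspecial group and for the braid group alike.
-/
theorem not_intertwines_lambdaOp {k : ℕ} (e : Qubits k ≃ₗ[ℂ] Qubits k)
    (he : ∀ i < 2 * k + 1, ∀ v, e (lambdaOp k 1 i v) = lambdaOp k (-1) i (e v)) : False := by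
  obtain ⟨c, hc⟩ := Representation.exists_eq_smul_one_of_commute (rho_isIrreducible k)
    (f := e.toLinearMap) fun g => LinearMap.ext fun v =>
      NearlyExtraspecial.intertwines (rho_odd k) (rho_odd k) e.toLinearMap (fun i v => by
        have := he i (by omega) v
        rwa [lambdaOp_of_lt _ i.2, lambdaOp_of_lt _ i.2, ← rho_x] at this) g v
  have he' : ∀ v, e v = c • v := fun v => congrArg (fun f : Module.End ℂ (Qubits k) => f v) hc
  obtain ⟨v, hv⟩ := exists_ne (0 : Qubits k)
  have h1 := he (2 * k) (by omega) v
  rw [he' v, lambdaOp_neg_one_last, LinearMap.neg_apply, map_smul, ← he'] at h1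
  have h2 := eq_zero_of_eq_neg h1
  rw [LinearEquiv.map_eq_zero_iff] at h2
  have h3 := (lambdaOp_extraspecialRelations k 1).sq_apply (show 2 * k < 2 * k + 1 by omega) v
  rw [h2, map_zero, zero_eq_neg] at h3
  exact hv h3

theorem isEmpty_lambda_equiv (k : ℕ) :
    IsEmpty (Representation.Equiv (lambda k 1) (lambda k (-1))) :=
  ⟨fun f => not_intertwines_lambdaOp f.toLinearEquiv fun i hi v => by
    have := Representation.IntertwiningMap.isIntertwining _ _ f.toIntertwiningMap
      (NearlyExtraspecial.x ⟨i, hi⟩) v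
    rw [lambda_x, lambda_x] at this
    exact this⟩

theorem isEmpty_lambdaHat_equiv (k : ℕ) :
    IsEmpty (Representation.Equiv (lambdaHat k 1) (lambdaHat k (-1))) :=
  ⟨fun f => not_intertwines_lambdaOp f.toLinearEquiv fun i hi v => by
    have := Representation.IntertwiningMap.isIntertwining _ _ f.toIntertwiningMap
      (BraidGroup.σ (n := 2 * k + 2) (⟨i, hi⟩ : Fin (2 * k + 1))) v
    rw [lambdaHat_σ, lambdaHat_σ, lambda_x, lambda_x, LinearMap.smul_apply, LinearMap.smul_apply,
      map_smul] at this
    have h := smul_right_injective _ sqrtTwo_inv_ne_zero this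
    rw [LinearMap.add_apply, LinearMap.add_apply, map_add] at h
    exact add_left_cancel h⟩

/-- The nonzero intertwiner given by `exists_ne_zero` is bijective by Schur's lemma. -/
theorem nonempty_equiv_rho {k : ℕ} {V : Type*} [AddCommGroup V] [Module ℂ V]
    [FiniteDimensional ℂ V] {τ : Representation ℂ (NearlyExtraspecial (2 * k)) V}
    (hτ : τ.IsIrreducible) (ho : IsOddRep τ) : Nonempty (Representation.Equiv τ (rho k)) := by
  have := hτ.nontrivial
  obtain ⟨f, hf0, hf⟩ := (NearlyExtraspecial.op_extraspecialRelations ho).exists_ne_zero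
    (rhoOp_extraspecialRelations k)
  refine NearlyExtraspecial.nonempty_equiv_of_ne_zero hτ (rho_isIrreducible k) ho (rho_odd k) hf0
    fun i v => ?_
  rw [rho_x, ← hf i i.2, NearlyExtraspecial.op_of_lt]

/-- The operators on `W₁ ⊕ W₂` extended by the one which exchanges the summands. -/
theorem lambdaOp_double (k : ℕ) :
    ExtraspecialRelations (A := Module.End ℂ (Qubits k × Qubits k)) (2 * (k + 1)) fun i =>
      if i < 2 * k + 1 then (lambdaOp k 1 i).prodMap (lambdaOp k (-1) i)
      else ExtraspecialRelations.quarterTurn (Qubits k) :=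
  (lambdaOp_extraspecialRelations k 1).double (lambdaOp_extraspecialRelations k (-1))
    (fun i hi => by rw [lambdaOp_of_lt _ hi, lambdaOp_of_lt _ hi]) (lambdaOp_neg_one_last k)

/-- Doubling both sides produces `2 k + 2` operators, an even number: `V ⊕ V`, where the last
generator acts with opposite signs on the summands, admits a nonzero intertwiner to `W₁ ⊕ W₂`.
Restricted to the first copy of `V`, this map has a nonzero component in `W₁` or in `W₂`, which is
an isomorphism by Schur's lemma. -/
theorem nonempty_equiv_lambda {k : ℕ} {V : Type*} [AddCommGroup V] [Module ℂ V]
    [FiniteDimensional ℂ V] {τ : Representation ℂ (NearlyExtraspecial (2 * k + 1)) V}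
    (hτ : τ.IsIrreducible) (ho : IsOddRep τ) :
    Nonempty (Representation.Equiv τ (lambda k 1)) ∨
      Nonempty (Representation.Equiv τ (lambda k (-1))) := by
  have := hτ.nontrivial
  have hJ := NearlyExtraspecial.op_extraspecialRelations ho
  have hD : ExtraspecialRelations (A := Module.End ℂ (V × V)) (2 * (k + 1)) _ :=
    hJ.double hJ.negLast (fun i hi => by rw [if_pos hi]) (by rw [if_neg (lt_irrefl _)])
  obtain ⟨f, hf0, hf⟩ := hD.exists_ne_zero (lambdaOp_double k)
  have hx : ∀ (i : Fin (2 * k + 1)) v,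
      f (τ (NearlyExtraspecial.x i) v, 0) = ((lambda k 1 (NearlyExtraspecial.x i) (f (v, 0)).1),
        (lambda k (-1) (NearlyExtraspecial.x i) (f (v, 0)).2)) := by
    intro i v
    have h := hf i (by omega) (v, 0)
    simp only [if_pos i.2, LinearMap.prodMap_apply, map_zero, NearlyExtraspecial.op_of_lt _ i.2]
      at h
    rw [h, lambda_x, lambda_x]
  -- The appended operator carries the first summand onto the second, so an intertwiner which
  -- vanishes on the first summand vanishes altogether.
  have h0 : ∃ v, f (v, 0) ≠ 0 := by
    by_contra! h
    refine hf0 (LinearMap.ext fun v => ?_)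
    have h1 : f (0, v.2) = 0 := by
      have h2 := hf (2 * k + 1) (by omega) (v.2, 0)
      simp only [if_neg (lt_irrefl _), h v.2, map_zero] at h2
      simpa [ExtraspecialRelations.quarterTurn] using h2
    have h2 : v = (v.1, 0) + (0, v.2) := by simp
    rw [h2, map_add, h, h1]
    simp
  obtain ⟨v, hv⟩ := h0
  by_cases h1 : (f (v, 0)).1 = 0
  · right
    refine NearlyExtraspecial.nonempty_equiv_of_ne_zero hτ (lambda_isIrreducible k _) ho
      (lambda_odd k _) (f := LinearMap.snd ℂ _ _ ∘ₗ f ∘ₗ LinearMap.inl ℂ V V)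
      (fun h => hv (Prod.ext h1 (congrArg (fun f : V →ₗ[ℂ] Qubits k => f v) h))) fun i v => ?_
    exact congrArg Prod.snd (hx i v)
  · left
    refine NearlyExtraspecial.nonempty_equiv_of_ne_zero hτ (lambda_isIrreducible k _) ho
      (lambda_odd k _) (f := LinearMap.fst ℂ _ _ ∘ₗ f ∘ₗ LinearMap.inl ℂ V V)
      (fun h => h1 (congrArg (fun f : V →ₗ[ℂ] Qubits k => f v) h)) fun i v => ?_
    exact congrArg Prod.fst (hx i v)

/-! ## The decomposition of the representation on `(ℂ²)^{⊗ n}` -/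

/-- A nonzero vector space is faithfully flat. This allows identities between operators on `V` to be
read off from the tensor power, where they act on `M ⊗ V`. -/
theorem lTensor_injective (M : Type*) [AddCommGroup M] [Module ℂ M] [Nontrivial M] {V : Type*}
    [AddCommGroup V] [Module ℂ V] {f g : Module.End ℂ V} (h : f.lTensor M = g.lTensor M) :
    f = g := by
  rw [← sub_eq_zero, Module.FaithfullyFlat.zero_iff_lTensor_zero ℂ M, LinearMap.lTensor_sub, h,
    sub_self]

theorem map_smul_one_add {V W : Type*} [AddCommGroup V] [Module ℂ V] [AddCommGroup W] [Module ℂ W]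
    {A : Module.End ℂ V} {B : Module.End ℂ W} (f : V →ₗ[ℂ] W) (h : ∀ v, f (A v) = B (f v)) (c : ℂ)
    (v : V) : f ((c • (1 + A)) v) = (c • (1 + B)) (f v) := by
  simp [h]

/-- An isomorphism which is compatible with the generators of the nearly extraspecial group is
compatible with the braid group and with the pure braid group. -/
theorem decomposition_of_generators {n : ℕ} (M : Type*) [AddCommGroup M] [Module ℂ M]
    [Nontrivial M] {V : Type*} [AddCommGroup V] [Module ℂ V]
    {ρ : Representation ℂ (NearlyExtraspecial (n - 1)) V} {σ : Representation ℂ (BraidGroup n) V}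
    (hρ : IsOddRep ρ)
    (hσ : ∀ i, σ (BraidGroup.σ i) = (((√2 : ℝ) : ℂ)⁻¹) • (1 + ρ (NearlyExtraspecial.x i)))
    (e : Qubits n ≃ₗ[ℂ] M ⊗[ℂ] V)
    (he : ∀ i v, e (qubitRep n (NearlyExtraspecial.x i) v) =
      (ρ (NearlyExtraspecial.x i)).lTensor M (e v)) :
    Nonempty (Representation.Equiv (yangBaxterRep n)
      (Representation.tprod (Representation.trivial ℂ (BraidGroup n) M) σ)) ∧
    restrictPure σ = pullback ρ (pureToExtraspecial n) ∧
    Nonempty (Representation.Equiv (restrictPure (yangBaxterRep n))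
      (Representation.tprod (Representation.trivial ℂ (PureBraidGroup n) M)
        (pullback ρ (pureToExtraspecial n)))) := by
  have hodd : IsOddRep (Representation.tprod
      (Representation.trivial ℂ (NearlyExtraspecial (n - 1)) M) ρ) := by
    rw [IsOddRep] at hρ ⊢
    rw [Representation.tprod_apply, hρ]
    exact TensorProduct.ext' fun a b => TensorProduct.tmul_neg a b
  have hE : ∀ g v, e (qubitRep n g v) = (ρ g).lTensor M (e v) :=
    NearlyExtraspecial.intertwines (qubitRep_odd n) hodd e.toLinearMap he
  have hB : ∀ b v, e (yangBaxterRep n b v) = (σ b).lTensor M (e v) := by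
    refine BraidGroup.intertwines (yangBaxterRep n)
      (Representation.tprod (Representation.trivial ℂ (BraidGroup n) M) σ) e.toLinearMap
      fun i v => ?_
    rw [yangBaxterRep_σ, map_smul_one_add e.toLinearMap (he i)]
    change _ = (σ (BraidGroup.σ i)).lTensor M (e v)
    rw [hσ, LinearMap.lTensor_smul, LinearMap.lTensor_add]
    congr 1
    rw [Module.End.one_eq_id, Module.End.one_eq_id, LinearMap.lTensor_id]
  have hP : ∀ (p : PureBraidGroup n) v, e (restrictPure (yangBaxterRep n) p v) =
      (pullback ρ (pureToExtraspecial n) p).lTensor M (e v) := fun p v => by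
    rw [← qubitRep_pureToExtraspecial]
    exact hE _ v
  refine ⟨⟨.mk e fun b => LinearMap.ext (hB b)⟩, ?_, ⟨.mk e fun p => LinearMap.ext (hP p)⟩⟩
  -- After tensoring with `M`, both sides are transported by `e` from the same operator, the action
  -- of the pure braid `p` on the tensor power.
  refine MonoidHom.ext fun p => lTensor_injective M (LinearMap.ext fun w => ?_)
  obtain ⟨v, rfl⟩ := e.surjective w
  rw [← hP]
  exact (hB p v).symm

theorem lTensor_extraspecialRelations {V : Type*} [AddCommGroup V] [Module ℂ V] {m : ℕ}
    {J : ℕ → Module.End ℂ V} (h : ExtraspecialRelations m J) (M : Type*) [AddCommGroup M]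
    [Module ℂ M] : ExtraspecialRelations (A := Module.End ℂ (M ⊗[ℂ] V)) m
      fun i => (J i).lTensor M :=
  h.map (Module.End.lTensorAlgHom ℂ V M)

/-- Both sides carry `2 k` operators with the relations, and `2 ^ (2 k + 1) = 2 ^ (k + 1) * 2 ^ k`.
-/
theorem exists_linearEquiv_rho (k : ℕ) :
    ∃ e : Qubits (2 * k + 1) ≃ₗ[ℂ] Qubits (k + 1) ⊗[ℂ] Qubits k, ∀ (i : Fin (2 * k)) v,
      e (qubitRep (2 * k + 1) (NearlyExtraspecial.x (m := 2 * k) i) v) =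
        (rho k (NearlyExtraspecial.x i)).lTensor (Qubits (k + 1)) (e v) := by
  obtain ⟨e, he⟩ := ExtraspecialRelations.exists_linearEquiv k
    (yangBaxter_extraspecialRelations (2 * k + 1))
    (lTensor_extraspecialRelations (rhoOp_extraspecialRelations k) (Qubits (k + 1)))
    (by
      rw [Module.finrank_tensorProduct, finrank_qubits, finrank_qubits, finrank_qubits]
      ring)
  refine ⟨e, fun i v => ?_⟩
  rw [rho_x, ← he i i.2]
  exact congrArg (fun f : Module.End ℂ (Qubits (2 * k + 1)) => e (f v))
    (qubitRep_x (n := 2 * k + 1) i)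

/-- The operators of the Yang–Baxter representation on an even number of factors, extended by one
which acts on the last factor. -/
theorem yangBaxter_extraspecialRelations_snoc (k : ℕ) :
    ExtraspecialRelations (A := Module.End ℂ (Qubits (2 * k + 2))) (2 * (k + 1)) fun i =>
      if i < 2 * k + 1 then site i matS * site (i + 1) matσx
      else Complex.I • site (2 * k + 1) matσz := by
  have h : ExtraspecialRelations (2 * k + 1) _ := yangBaxter_extraspecialRelations (2 * k + 2)
  refine h.snoc ?_ (fun i hi => ?_) ?_
  · rw [smul_mul_smul_comm, site_matσz_sq, Complex.I_mul_I, neg_one_smul]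
  · have h1 : Commute (site i matS * site (i + 1) matσx : Module.End ℂ (Qubits (2 * k + 2)))
        (site (2 * k + 1) matσz) :=
      Commute.mul_left (site_comm (by omega) _ _) (site_comm (by omega) _ _)
    exact (h1.smul_right _).eq
  · rw [smul_mul_assoc, mul_smul_comm, ← smul_neg, ← mul_assoc,
      site_comm (show 2 * k + 1 ≠ 2 * k by omega), mul_assoc, site_mul, matσz_mul_matσx,
      site_neg (by omega), ← site_mul, mul_neg, mul_assoc]

theorem prod_lambda_x {k : ℕ} (i : Fin (2 * k + 1)) :
    (lambda k 1).prod (lambda k (-1)) (NearlyExtraspecial.x i) =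
      (lambdaOp k 1 i).prodMap (lambdaOp k (-1) i) := by
  rw [← lambda_x, ← lambda_x]
  rfl

theorem prod_lambda_odd (k : ℕ) : IsOddRep ((lambda k 1).prod (lambda k (-1))) := by
  have h1 := lambda_odd k 1
  have h2 := lambda_odd k (-1)
  rw [IsOddRep] at h1 h2 ⊢
  change (lambda k 1 _).prodMap (lambda k (-1) _) = -1
  rw [h1, h2]
  exact LinearMap.ext fun v => rfl

theorem prod_lambdaHat_σ {k : ℕ} (i : Fin (2 * k + 1)) :
    (lambdaHat k 1).prod (lambdaHat k (-1)) (BraidGroup.σ (n := 2 * k + 2) i) =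
      (((√2 : ℝ) : ℂ)⁻¹) •
        (1 + (lambda k 1).prod (lambda k (-1)) (NearlyExtraspecial.x i)) := by
  change (lambdaHat k 1 _).prodMap (lambdaHat k (-1) _) = _
  rw [lambdaHat_σ, lambdaHat_σ]
  exact LinearMap.ext fun v => rfl

/-- For the `2 k + 1` operators alone, the dimension would not fix the multiplicities of `W₁` and
`W₂`. The operator appended on each side forces them to be equal: the extended families have `2 k +
2` members on spaces of the same dimension, hence are isomorphic, and the appended operator is then
forgotten. -/
theorem exists_linearEquiv_lambda (k : ℕ) :
    ∃ e : Qubits (2 * k + 2) ≃ₗ[ℂ] Qubits (k + 1) ⊗[ℂ] (Qubits k × Qubits k),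
      ∀ (i : Fin (2 * k + 1)) v,
      e (qubitRep (2 * k + 2) (NearlyExtraspecial.x (m := 2 * k + 1) i) v) =
        ((lambda k 1).prod (lambda k (-1)) (NearlyExtraspecial.x i)).lTensor
          (Qubits (k + 1)) (e v) := by
  obtain ⟨e, he⟩ := ExtraspecialRelations.exists_linearEquiv (k + 1)
    (yangBaxter_extraspecialRelations_snoc k)
    (lTensor_extraspecialRelations (lambdaOp_double k) (Qubits (k + 1)))
    (by
      rw [Module.finrank_tensorProduct, Module.finrank_prod, finrank_qubits, finrank_qubits,
        finrank_qubits]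
      ring)
  refine ⟨e, fun i v => ?_⟩
  have h := he i (by omega) v
  simp only [if_pos i.2] at h
  rw [prod_lambda_x, ← h]
  exact congrArg (fun f : Module.End ℂ (Qubits (2 * k + 2)) => e (f v))
    (qubitRep_x (n := 2 * k + 2) i)

/-- The `2 k + 2` operators of `rho (k + 1)` and those of `lambdaOp_double` act on spaces of
dimension `2 ^ (k + 1)`, so they are isomorphic. Restriction to one strand fewer forgets the last
operator. -/
theorem nonempty_equiv_restriction (k : ℕ) :
    Nonempty (Representation.Equiv
      (pullback (rhoHat (k + 1)) (BraidGroup.addStrand (2 * k + 2)))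
      (Representation.prod (lambdaHat k 1) (lambdaHat k (-1)))) := by
  obtain ⟨e, he⟩ := ExtraspecialRelations.exists_linearEquiv (k + 1)
    (rhoOp_extraspecialRelations (k + 1)) (lambdaOp_double k)
    (by
      rw [Module.finrank_prod, finrank_qubits, finrank_qubits]
      ring)
  refine ⟨.mk e fun b => LinearMap.ext fun v => ?_⟩
  refine BraidGroup.intertwines (n := 2 * k + 2)
    (pullback (rhoHat (k + 1)) (BraidGroup.addStrand (2 * k + 2)))
    ((lambdaHat k 1).prod (lambdaHat k (-1))) e.toLinearMap (fun i v => ?_) b v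
  have hi : (i : ℕ) < 2 * k + 1 := i.2
  have h1 : pullback (rhoHat (k + 1)) (BraidGroup.addStrand (2 * k + 2)) (BraidGroup.σ i) =
      (((√2 : ℝ) : ℂ)⁻¹) • (1 + rhoOp (k + 1) i) := by
    have h2 : BraidGroup.addStrand (2 * k + 2) (BraidGroup.σ i) =
        BraidGroup.σ (n := 2 * (k + 1) + 1) (⟨i, by omega⟩ : Fin (2 * (k + 1))) :=
      BraidGroup.lift_σ _ _ _ i
    change rhoHat (k + 1) (BraidGroup.addStrand (2 * k + 2) (BraidGroup.σ i)) = _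
    rw [h2, rhoHat_σ, rho_x]
  rw [h1, prod_lambdaHat_σ (k := k) i, prod_lambda_x]
  refine map_smul_one_add e.toLinearMap (fun v => ?_) _ v
  have h := he i (by omega) v
  rw [if_pos hi] at h
  exact h

/-! ### The decomposition theorem -/

theorem theorem4p4 :
    -- the case of `n = 2 k + 1` strands
    (∀ k : ℕ,
      -- `V₁` is the unique odd irreducible representation, of dimension `2 ^ k`
      Module.finrank ℂ (Qubits k) = 2 ^ k ∧
      (rho k).IsIrreducible ∧ IsOddRep (rho k) ∧
      (∀ (U : Type u) [AddCommGroup U] [Module ℂ U] [FiniteDimensional ℂ U]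
        (τ : Representation ℂ (NearlyExtraspecial (2 * k)) U), τ.IsIrreducible →
        (IsOddRep τ ∨ (1 ≤ k ∧ Module.finrank ℂ U = 2 ^ k)) →
        Nonempty (Representation.Equiv τ (rho k))) ∧
      -- the decomposition as a representation of the braid group
      (rhoHat k).IsIrreducible ∧
      Nonempty (Representation.Equiv (yangBaxterRep (2 * k + 1))
        (Representation.tprod
          (Representation.trivial ℂ (BraidGroup (2 * k + 1)) (Qubits (k + 1))) (rhoHat k))) ∧
      -- the restriction to the pure braid group
      ∃ θ : PureBraidGroup (2 * k + 1) →* NearlyExtraspecial (2 * k),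
        (∀ i : Fin (2 * k), θ (PureBraidGroup.σsq (n := 2 * k + 1) i) = NearlyExtraspecial.x i) ∧
        (1 ≤ k → Function.Surjective θ) ∧
        (∀ p, θ p = 1 ↔ restrictPure (yangBaxterRep (2 * k + 1)) p = 1) ∧
        restrictPure (rhoHat k) = pullback (rho k) θ ∧
        Nonempty (Representation.Equiv (restrictPure (yangBaxterRep (2 * k + 1)))
          (Representation.tprod
            (Representation.trivial ℂ (PureBraidGroup (2 * k + 1)) (Qubits (k + 1)))
            (pullback (rho k) θ)))) ∧
    -- the case of `n = 2 k + 2` strands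
    (∀ k : ℕ,
      -- `W₁` and `W₂` are the two odd irreducible representations, both of dimension `2 ^ k`
      Module.finrank ℂ (Qubits k) = 2 ^ k ∧
      (∀ ε : ℤˣ, (lambda k ε).IsIrreducible ∧ IsOddRep (lambda k ε)) ∧
      IsEmpty (Representation.Equiv (lambda k 1) (lambda k (-1))) ∧
      (∀ (U : Type u) [AddCommGroup U] [Module ℂ U] [FiniteDimensional ℂ U]
        (τ : Representation ℂ (NearlyExtraspecial (2 * k + 1)) U), τ.IsIrreducible →
        (IsOddRep τ ∨ (1 ≤ k ∧ Module.finrank ℂ U = 2 ^ k)) →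
        Nonempty (Representation.Equiv τ (lambda k 1)) ∨
          Nonempty (Representation.Equiv τ (lambda k (-1)))) ∧
      -- the decomposition as a representation of the braid group
      (∀ ε : ℤˣ, (lambdaHat k ε).IsIrreducible) ∧
      IsEmpty (Representation.Equiv (lambdaHat k 1) (lambdaHat k (-1))) ∧
      Nonempty (Representation.Equiv (pullback (rhoHat (k + 1)) (BraidGroup.addStrand (2 * k + 2)))
        (Representation.prod (lambdaHat k 1) (lambdaHat k (-1)))) ∧
      Nonempty (Representation.Equiv (yangBaxterRep (2 * k + 2))
        (Representation.tprod
          (Representation.trivial ℂ (BraidGroup (2 * k + 2)) (Qubits (k + 1)))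
          (Representation.prod (lambdaHat k 1) (lambdaHat k (-1))))) ∧
      -- the restriction to the pure braid group
      ∃ θ : PureBraidGroup (2 * k + 2) →* NearlyExtraspecial (2 * k + 1),
        (∀ i : Fin (2 * k + 1),
          θ (PureBraidGroup.σsq (n := 2 * k + 2) i) = NearlyExtraspecial.x i) ∧
        Function.Surjective θ ∧
        (∀ p, θ p = 1 ↔ restrictPure (yangBaxterRep (2 * k + 2)) p = 1) ∧
        (∀ ε : ℤˣ, restrictPure (lambdaHat k ε) = pullback (lambda k ε) θ) ∧
        Nonempty (Representation.Equiv (restrictPure (yangBaxterRep (2 * k + 2)))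
          (Representation.tprod
            (Representation.trivial ℂ (PureBraidGroup (2 * k + 2)) (Qubits (k + 1)))
            (Representation.prod (pullback (lambda k 1) θ) (pullback (lambda k (-1)) θ))))) := by
  refine ⟨fun k => ?_, fun k => ?_⟩
  · obtain ⟨e, he⟩ := exists_linearEquiv_rho k
    obtain ⟨h1, h2, h3⟩ := decomposition_of_generators (n := 2 * k + 1) (Qubits (k + 1))
      (rho_odd k) rhoHat_σ e he
    refine ⟨finrank_qubits k, rho_isIrreducible k, rho_odd k, ?_, rhoHat_isIrreducible k, h1,
      pureToExtraspecial (2 * k + 1), pureToExtraspecial_σsq (n := 2 * k + 1),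
      fun hk => pureToExtraspecial_surjective (by omega), pureToExtraspecial_eq_one_iff, h2, h3⟩
    rintro U _ _ _ τ hτ (ho | ⟨hk, hd⟩)
    · exact nonempty_equiv_rho hτ ho
    -- For `k ≥ 1` the dimension `2 ^ k` exceeds one, which forces oddness; for `k = 0` there are
    -- also one-dimensional representations which are not odd.
    · exact nonempty_equiv_rho hτ (NearlyExtraspecial.isOddRep_of_finrank_ne_one hτ
        (by rw [hd]; exact (Nat.one_lt_two_pow (by omega)).ne'))
  · obtain ⟨e, he⟩ := exists_linearEquiv_lambda k
    obtain ⟨h1, h2, h3⟩ := decomposition_of_generators (n := 2 * k + 2) (Qubits (k + 1))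
      (prod_lambda_odd k) prod_lambdaHat_σ e he
    refine ⟨finrank_qubits k, fun ε => ⟨lambda_isIrreducible k ε, lambda_odd k ε⟩,
      isEmpty_lambda_equiv k, ?_, lambdaHat_isIrreducible k, isEmpty_lambdaHat_equiv k,
      nonempty_equiv_restriction k, h1,
      pureToExtraspecial (2 * k + 2), pureToExtraspecial_σsq (n := 2 * k + 2),
      pureToExtraspecial_surjective (by omega), pureToExtraspecial_eq_one_iff, ?_, h3⟩
    · rintro U _ _ _ τ hτ (ho | ⟨hk, hd⟩)
      · exact nonempty_equiv_lambda hτ ho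
      · exact nonempty_equiv_lambda hτ (NearlyExtraspecial.isOddRep_of_finrank_ne_one hτ
          (by rw [hd]; exact (Nat.one_lt_two_pow (by omega)).ne'))
    · intro ε
      refine MonoidHom.ext fun p => LinearMap.ext fun v => ?_
      -- The identity is known on `W₁ ⊕ W₂`; evaluation at `(v, v)` gives it on both summands at
      -- once.
      have h := congrArg (fun f : Module.End ℂ (Qubits k × Qubits k) => f (v, v))
        (DFunLike.congr_fun h2 p)
      rcases Int.units_eq_one_or ε with rfl | rfl
      · exact congrArg Prod.fst h
      · exact congrArg Prod.snd h
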